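/- Let $M$ be a compact complex manifold of complex dimension $n$ with a smooth Hermitian metric $g$, and let $\omega=\sqrt{-1}\sum_{i,j} g_{i\bar j}\,dz^i\wedge d\bar z^j$ be the associated real $(1,1)$-form. Assume that either (a) $n=2$, or (b) $n>2$ and $g$ is balanced, i.e. $d(\omega^{n-1})=0$. Write $\Delta f=g^{i\bar j}\partial_i\partial_{\bar j}f$ for the Laplacian of the Chern connection of $g$. Then for every real number $K$ there exist constants $C>0$ and $A>0$, depending only on $(M,g)$ and $K$, with the following property. Let $F$ be a smooth real-valued function on $M$ with $|F|\le K$ and $|\Delta F|\le K$ on $M$, and let $\varphi$ be a smooth real-valued function on $M$ with $\sup_M\varphi=0$ that solves the complex Monge–Ampère equation $$(\omega+\sqrt{-1}\,\partial\bar\partial\varphi)^n=e^F\omega^n,\qquad \omega+\sqrt{-1}\,\partial\bar\partial\varphi>0 .$$ Let $g'$ be the Hermitian metric $g'_{i\bar j}=g_{i\bar j}+\partial_i\partial_{\bar j}\varphi$ and let $\mathrm{tr}_g g'=g^{i\bar j}g'_{i\bar j}$. Then $$\mathrm{tr}_g g'\le C\,e^{A(\varphi-\inf_M\varphi)}\qquad\text{on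 } M .$$ -/

import Mathlib

open Set Function
open scoped Manifold ContDiff Matrix ComplexConjugate ComplexOrder

noncomputable section

namespace HermitianMA

/-- Model space `ℂⁿ`. -/
abbrev Cn (n : ℕ) : Type := Fin n → ℂ

/-- Complex-valued real-multilinear alternating `k`-forms on `ℂⁿ`, i.e. complex-valued covectors
of degree `k` on the underlying real vector space. -/
abbrev CForm (n k : ℕ) : Type := Cn n [⋀^Fin k]→L[ℝ] ℂ

/-! ### Exterior algebra -/

/-- The tensor product `(v₁,…,v_{p+q}) ↦ α(v₁,…,v_p) β(v_{p+1},…,v_{p+q})`. -/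
def tensor {n p q : ℕ} (α : CForm n p) (β : CForm n q) :
    ContinuousMultilinearMap ℝ (fun _ : Fin (p + q) => Cn n) ℂ where
  toFun v := α (fun i => v (Fin.castAdd q i)) * β (fun j => v (Fin.natAdd p j))
  map_update_add' := by
    intro hd m i x y
    obtain rfl : hd = instDecidableEqFin (p + q) := Subsingleton.elim _ _
    have hl : ∀ (k : Fin p) (z : Cn n), (fun i => update m (Fin.castAdd q k) z (Fin.castAdd q i))
        = update (fun i => m (Fin.castAdd q i)) k z := fun k z =>
      update_comp_eq_of_injective m (Fin.castAdd_injective p q) k z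
    have hr : ∀ (k : Fin q) (z : Cn n), (fun i => update m (Fin.natAdd p k) z (Fin.natAdd p i))
        = update (fun i => m (Fin.natAdd p i)) k z := fun k z =>
      update_comp_eq_of_injective m (Fin.natAdd_injective q p) k z
    refine Fin.addCases (fun k => ?_) (fun k => ?_) i
    · have hne : ∀ j : Fin q, Fin.natAdd p j ≠ Fin.castAdd q k := fun j h => by
        have := congrArg Fin.val h; simp at this; omega
      simp only [hl, ContinuousAlternatingMap.map_update_add, update_of_ne (hne _), add_mul]
    · have hne : ∀ j : Fin p, Fin.castAdd q j ≠ Fin.natAdd p k := fun j h => by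
        have := congrArg Fin.val h; simp at this; omega
      simp only [hr, ContinuousAlternatingMap.map_update_add, update_of_ne (hne _), mul_add]
  map_update_smul' := by
    intro hd m i c x
    obtain rfl : hd = instDecidableEqFin (p + q) := Subsingleton.elim _ _
    have hl : ∀ (k : Fin p) (z : Cn n), (fun i => update m (Fin.castAdd q k) z (Fin.castAdd q i))
        = update (fun i => m (Fin.castAdd q i)) k z := fun k z =>
      update_comp_eq_of_injective m (Fin.castAdd_injective p q) k z
    have hr : ∀ (k : Fin q) (z : Cn n), (fun i => update m (Fin.natAdd p k) z (Fin.natAdd p i))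
        = update (fun i => m (Fin.natAdd p i)) k z := fun k z =>
      update_comp_eq_of_injective m (Fin.natAdd_injective q p) k z
    refine Fin.addCases (fun k => ?_) (fun k => ?_) i
    · have hne : ∀ j : Fin q, Fin.natAdd p j ≠ Fin.castAdd q k := fun j h => by
        have := congrArg Fin.val h; simp at this; omega
      simp only [hl, ContinuousAlternatingMap.map_update_smul, update_of_ne (hne _), smul_mul_assoc]
    · have hne : ∀ j : Fin p, Fin.castAdd q j ≠ Fin.natAdd p k := fun j h => by
        have := congrArg Fin.val h; simp at this; omega
      simp only [hr, ContinuousAlternatingMap.map_update_smul, update_of_ne (hne _), mul_smul_comm]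
  cont := by
    refine Continuous.mul ?_ ?_
    · exact α.cont.comp (continuous_pi fun i => continuous_apply _)
    · exact β.cont.comp (continuous_pi fun i => continuous_apply _)

/-- The wedge product, normalized so that
`(α ∧ β)(v) = (p! q!)⁻¹ ∑_σ sgn(σ) α(v_{σ(1)},…,v_{σ(p)}) β(v_{σ(p+1)},…,v_{σ(p+q)})`. -/
def wedge {n p q : ℕ} (α : CForm n p) (β : CForm n q) : CForm n (p + q) :=
  ((p.factorial * q.factorial : ℝ)⁻¹) • ContinuousMultilinearMap.alternatization (tensor α β)

/-- The wedge powers `α ∧ ⋯ ∧ α` (`k` factors) of a `2`-form. -/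
def wedgePow {n : ℕ} (α : CForm n 2) : (k : ℕ) → CForm n (2 * k)
  | 0 => ContinuousAlternatingMap.constOfIsEmpty ℝ (Cn n) (Fin 0) 1
  | k + 1 => wedge (wedgePow α k) α

/-- The `1`-form `dzⁱ`. -/
def dz {n : ℕ} (i : Fin n) : CForm n 1 :=
  ContinuousAlternatingMap.ofSubsingleton ℝ (Cn n) ℂ (0 : Fin 1)
    (ContinuousLinearMap.proj (R := ℝ) (φ := fun _ : Fin n => ℂ) i)

/-- The `1`-form `dz̄ⁱ`. -/
def dzbar {n : ℕ} (i : Fin n) : CForm n 1 :=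
  ContinuousAlternatingMap.ofSubsingleton ℝ (Cn n) ℂ (0 : Fin 1)
    ((Complex.conjCLE : ℂ →L[ℝ] ℂ).comp
      (ContinuousLinearMap.proj (R := ℝ) (φ := fun _ : Fin n => ℂ) i))

/-- The `(1,1)`-form `√-1 ∑ᵢⱼ Hᵢⱼ dzⁱ ∧ dz̄ʲ` with coefficient matrix `H`. -/
def formOfMatrix {n : ℕ} (H : Matrix (Fin n) (Fin n) ℂ) : CForm n 2 :=
  Complex.I • ∑ i, ∑ j, H i j • wedge (dz i) (dzbar j)

/-! ### Wirtinger derivatives -/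

/-- `∂f/∂zⁱ = ½ (∂f/∂xⁱ - √-1 ∂f/∂yⁱ)`. -/
def dWirt {n : ℕ} (i : Fin n) (f : Cn n → ℂ) (z : Cn n) : ℂ :=
  (1 / 2) * (fderiv ℝ f z (Pi.single i 1) - Complex.I * fderiv ℝ f z (Pi.single i Complex.I))

/-- `∂f/∂z̄ⁱ = ½ (∂f/∂xⁱ + √-1 ∂f/∂yⁱ)`. -/
def dbarWirt {n : ℕ} (i : Fin n) (f : Cn n → ℂ) (z : Cn n) : ℂ :=
  (1 / 2) * (fderiv ℝ f z (Pi.single i 1) + Complex.I * fderiv ℝ f z (Pi.single i Complex.I))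

/-! ### Hermitian metrics on complex manifolds -/

section Manifold

variable {n : ℕ} {M : Type*} [TopologicalSpace M] [ChartedSpace (Cn n) M]

/-- The holomorphic coordinate charts of `M`. -/
def holCharts (n : ℕ) (M : Type*) [TopologicalSpace M] [ChartedSpace (Cn n) M] :
    Set (OpenPartialHomeomorph M (Cn n)) :=
  IsManifold.maximalAtlas 𝓘(ℂ, Cn n) ω M

/-- The coordinate vector field `∂/∂zⁱ` of the chart `e`, at the point with coordinates `z`. -/
def coordVec (e : OpenPartialHomeomorph M (Cn n)) (z : Cn n) (i : Fin n) :
    TangentSpace 𝓘(ℂ, Cn n) (e.symm z) :=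
  mfderiv 𝓘(ℂ, Cn n) 𝓘(ℂ, Cn n) e.symm z (Pi.single i (1 : ℂ) : Cn n)

/-- A (smooth) Hermitian metric on the complex manifold `M`: a positive definite Hermitian form on
each holomorphic tangent space, linear in the first and conjugate-linear in the second variable,
whose coefficients in holomorphic coordinates are smooth in the real sense. -/
structure HermitianMetric (n : ℕ) (M : Type*) [TopologicalSpace M] [ChartedSpace (Cn n) M] where
  form : ∀ x : M, TangentSpace 𝓘(ℂ, Cn n) x →ₗ[ℂ] TangentSpace 𝓘(ℂ, Cn n) x →ₗ⋆[ℂ] ℂ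
  symm : ∀ x v w, form x w v = conj (form x v w)
  pos : ∀ x v, v ≠ 0 → 0 < (form x v v).re
  smooth : ∀ e ∈ holCharts n M, ∀ i j : Fin n,
    ContDiffOn ℝ ∞ (fun z => form (e.symm z) (coordVec e z i) (coordVec e z j)) e.target

/-- The complex Hessian `(∂ᵢ∂_{j̄} f)` of a real function in the chart `e`. -/
def complexHessian (e : OpenPartialHomeomorph M (Cn n)) (f : M → ℝ) (z : Cn n) :
    Matrix (Fin n) (Fin n) ℂ :=
  Matrix.of fun i j => dWirt i (dbarWirt j fun w => (f (e.symm w) : ℂ)) z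

namespace HermitianMetric

variable (g : HermitianMetric n M)

/-- The coefficients `g_{i j̄}` in the chart `e`. -/
def coeff (e : OpenPartialHomeomorph M (Cn n)) (z : Cn n) : Matrix (Fin n) (Fin n) ℂ :=
  Matrix.of fun i j => g.form (e.symm z) (coordVec e z i) (coordVec e z j)

/-- The coefficients `g'_{i j̄} = g_{i j̄} + ∂ᵢ∂_{j̄} φ` in the chart `e`. -/
def coeff' (φ : M → ℝ) (e : OpenPartialHomeomorph M (Cn n)) (z : Cn n) :
    Matrix (Fin n) (Fin n) ℂ :=
  g.coeff e z + complexHessian e φ z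

/-- The metric is balanced: the `(n-1)`-st power of its associated form
`√-1 ∑ g_{i j̄} dzⁱ ∧ dz̄ʲ` is closed. -/
def IsBalanced : Prop :=
  ∀ e ∈ holCharts n M, ∀ z ∈ e.target,
    extDeriv (fun w => wedgePow (formOfMatrix (g.coeff e w)) (n - 1)) z = 0

/-- `φ` solves `(ω + √-1 ∂∂̄φ)ⁿ = e^F ωⁿ` with `ω + √-1 ∂∂̄φ > 0`, where
`ω = √-1 ∑ g_{i j̄} dzⁱ ∧ dz̄ʲ`. -/
def SolvesMongeAmpere (F φ : M → ℝ) : Prop :=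
  ∀ e ∈ holCharts n M, ∀ z ∈ e.target,
    (g.coeff' φ e z).PosDef ∧
    wedgePow (formOfMatrix (g.coeff' φ e z)) n =
      (Real.exp (F (e.symm z)) : ℂ) • wedgePow (formOfMatrix (g.coeff e z)) n

/-- The trace `g^{i j̄} H_{i j̄}` in the chart `e`; it is real when `H` is Hermitian. -/
def traceIn (e : OpenPartialHomeomorph M (Cn n)) (z : Cn n) (H : Matrix (Fin n) (Fin n) ℂ) : ℝ :=
  ((g.coeff e z)⁻¹ * H).trace.re

/-- The Chern Laplacian `Δf = g^{i j̄} ∂ᵢ∂_{j̄} f` in the chart `e`. -/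
def laplacianIn (e : OpenPartialHomeomorph M (Cn n)) (f : M → ℝ) (z : Cn n) : ℝ :=
  g.traceIn e z (complexHessian e f z)

/-- `tr_g g' = g^{i j̄} g'_{i j̄}` in the chart `e`. -/
def traceMetricIn (e : OpenPartialHomeomorph M (Cn n)) (φ : M → ℝ) (z : Cn n) : ℝ :=
  g.traceIn e z (g.coeff' φ e z)

end HermitianMetric

end Manifold

end HermitianMA

end

/-!
The estimate is proved with the test function `log tr_g g' - A φ + 1 / (φ - inf φ + 1)`. The last
term absorbs the contribution of the torsion trace of `g`, so the argument works for every
Hermitian metric; the dimension and balancedness assumptions enter only through `0 < n`.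
-/

/-! Write `u = tr_g g'`, `m = inf φ`, and let `λ_i` be the eigenvalues of `g'` with respect to `g`.
The Monge–Ampère equation pins `∏ λ_i` between `e^{-K}` and `e^K`, so a bound on `τ = ∑ 1/λ_i` at a
point bounds `u` there. Such a bound comes from the maximum principle for `Q = log u - A φ + r`,
where `r = 1/(φ - m + 1)`.

Differentiating the equation twice gives a lower bound for the `g'`-Laplacian of `u`
(`trace_jet_inequality`). The third order terms carry a good square. Since `g' - g` is a complex
Hessian, `g` and `g'` have the same torsion, and Cauchy–Schwarz applied to that square yields
`|∂u|²/u`, up to a cross term `2 Re⟨∂u, b⟩/u` with the torsion trace `b` of `g`. The square cancels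
the gradient term of `log u`; the cross term is the obstacle on a general Hermitian manifold. At a
maximum of `Q` one has `∂u/u = (A + r²) ∂φ`, so after division by `u` the cross term is of size
`|∂φ|/u`. The Hessian of `r` contributes `2 r³ |∂φ|²`, which absorbs it as soon as `r³ u²` exceeds a
constant (`trace_le_of_jet`). The remaining errors are at most a constant times `τ`, and `-A φ`
dominates them for large `A`.

Hence at the maximum point either `r³ u²` or `u` is bounded, and in both cases `u ≤ C (φ - m + 1)²`.
This polynomial is absorbed by `e^{A(φ - m)}`, and since `0 < r ≤ 1`, comparing `Q` with its maximum
costs only a factor `e` (`exists_traceMetricIn_le`).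

The jets at the maximum point are computed in a constant frame simultaneously diagonalizing `g` and
`g'` (`trace_le_of_isLocalMax_frame`, `trace_le_of_isLocalMax`), so no normal coordinates are
needed. `det_eq_of_wedgePow_eq` turns the equation between forms into one between determinants, and
compactness makes the constants uniform (`exists_uniform_jetBound`). -/

namespace HermitianMA

/-! ### Pointwise inequalities for jets at the maximum point -/

open Complex

/-- Completing the square. -/
theorem normSq_div_sub_two_re (h g : ℂ) {l : ℝ} (hl : 0 < l) :
    normSq h / l - 2 * (conj g * h).re = normSq (h - g * l) / l - normSq g * l := by
  simp only [normSq_apply, mul_re, conj_re, conj_im, sub_re, sub_im, mul_im, ofReal_re, ofReal_im]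
  field_simp
  ring

theorem re_conj_mul_le {a b : ℂ} {x y : ℝ} (ha : ‖a‖ ≤ x) (hb : ‖b‖ ≤ y) :
    (conj a * b).re ≤ x * y := by
  calc (conj a * b).re ≤ ‖conj a * b‖ := re_le_norm _
    _ = ‖a‖ * ‖b‖ := by simp
    _ ≤ x * y := mul_le_mul ha hb (norm_nonneg _) ((norm_nonneg _).trans ha)

theorem normSq_le_sq {a : ℂ} {x : ℝ} (ha : ‖a‖ ≤ x) : normSq a ≤ x ^ 2 := by
  rw [normSq_eq_norm_sq]
  exact pow_le_pow_left₀ (norm_nonneg _) ha 2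

/-- In the application `t` is a torsion component of `g`: it appears when two indices of a
derivative of `g'` are exchanged. The bounds on `g` and `t` make its pairing with `g` cost at most
`4 B²`. -/
theorem normSq_div_sub_two_re_ge {h g t : ℂ} {l B : ℝ} (hl : 0 < l) (hg : ‖g‖ ≤ B)
    (ht : ‖t‖ ≤ 2 * B) :
    normSq (h - g * l) / l - (B ^ 2 * l + 4 * B ^ 2) ≤
      normSq h / l - 2 * (conj g * (h + t)).re := by
  have h1 := normSq_div_sub_two_re h g hl
  have h2 := re_conj_mul_le hg ht
  have h3 := mul_le_mul_of_nonneg_right (normSq_le_sq hg) hl.le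
  rw [mul_add, add_re]
  linarith

/-- Cauchy–Schwarz with weights. -/
theorem normSq_sum_le {ι : Type*} [Fintype ι] (a : ι → ℂ) {l : ι → ℝ} (hl : ∀ i, 0 < l i) :
    normSq (∑ k, a k) ≤ (∑ k, l k) * ∑ k, normSq (a k) / l k := by
  have h1 : ‖∑ k, a k‖ ≤ ∑ k, ‖a k‖ := norm_sum_le _ _
  have h2 := Finset.sum_sq_le_sum_mul_sum_of_sq_le_mul Finset.univ (r := fun k => ‖a k‖)
    (f := l) (g := fun k => normSq (a k) / l k) (fun k _ => (hl k).le)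
    (fun k _ => div_nonneg (normSq_nonneg _) (hl k).le)
    (fun k _ => by rw [normSq_eq_norm_sq, mul_div_cancel₀ _ (hl k).ne'])
  rw [normSq_eq_norm_sq]
  exact (pow_le_pow_left₀ (norm_nonneg _) h1 2).trans h2

theorem normSq_sub_two_re_le (u b : ℂ) : normSq u - 2 * (u * conj b).re ≤ normSq (u - b) := by
  rw [normSq_sub]
  linarith [normSq_nonneg b]

/-- The second-order inequality for the trace `∑ λ`, in terms of the jets of two metrics at a point
where the first one is the identity and the second one is diagonal with eigenvalues `λ`. Here
`g1 i k l = ∂ᵢ g_{k l̄}` and `g2 i k = ∂ᵢ∂_{ī} g_{k k̄}`, and `u1`, `u2` are the derivatives of the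
trace. -/
theorem trace_jet_inequality {n : ℕ} {lam : Fin n → ℝ} (hlam : ∀ i, 0 < lam i)
    {g1 h1 : Fin n → Fin n → Fin n → ℂ} {g2 h2 : Fin n → Fin n → ℝ} {u1 : Fin n → ℂ}
    {u2 F2 : Fin n → ℝ} {B K : ℝ}
    (ht : ∀ i k l, h1 i k l - h1 k i l = g1 i k l - g1 k i l)
    (hs : ∀ i k, h2 i k - h2 k i = g2 i k - g2 k i)
    (hu1 : ∀ i, u1 i = ∑ k, (h1 i k k - g1 i k k * lam k))
    (hu2 : ∀ i, u2 i = ∑ k, h2 i k - ∑ k, ∑ l, 2 * (conj (g1 i k l) * h1 i k l).re +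
      ∑ k, lam k * (∑ l, normSq (g1 i k l) + ∑ l, normSq (g1 i l k) - g2 i k))
    (hMA : ∀ k, ∑ i, h2 k i / lam i - ∑ i, ∑ l, normSq (h1 k i l) / (lam i * lam l) =
      F2 k + ∑ i, g2 k i - ∑ i, ∑ l, normSq (g1 k i l))
    (hF : -K ≤ ∑ k, F2 k)
    (hg1 : ∀ i k l, ‖g1 i k l‖ ≤ B) (hg2 : ∀ i k, |g2 i k| ≤ B) :
    (∑ i, normSq (u1 i) / lam i - 2 * ∑ i, (u1 i * conj (∑ k, (g1 i k k - g1 k i k))).re / lam i)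
        / (∑ i, lam i)
      - (B + n * B ^ 2) * (∑ i, lam i) * (∑ i, (lam i)⁻¹)
      - (2 * n * B + 4 * n ^ 2 * B ^ 2) * (∑ i, (lam i)⁻¹) - (K + n ^ 2 * B + n ^ 3 * B ^ 2)
      ≤ ∑ i, u2 i / lam i := by
  rcases Nat.eq_zero_or_pos n with rfl | hn
  · have hK : -K ≤ 0 := by simpa using hF
    simp; linarith
  have : Nonempty (Fin n) := ⟨⟨0, hn⟩⟩
  have hpos : 0 < ∑ i, lam i := Finset.sum_pos (fun i _ => hlam i) Finset.univ_nonempty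
  -- `Z` is the diagonal part (`k = l`) of the completed square below. Its row sums are `∂_i u`
  -- minus the torsion trace.
  set Z : Fin n → Fin n → ℂ := fun i k => h1 k i k - g1 i k k * lam k with hZ
  -- the good quadratic terms control the gradient term
  have good : (∑ i, normSq (u1 i) / lam i -
      2 * ∑ i, (u1 i * conj (∑ k, (g1 i k k - g1 k i k))).re / lam i) / (∑ i, lam i) ≤
      ∑ i, ∑ k, normSq (Z i k) / (lam i * lam k) := by
    rw [div_le_iff₀ hpos, Finset.mul_sum, ← Finset.sum_sub_distrib, Finset.sum_mul]
    refine Finset.sum_le_sum fun i _ => ?_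
    have e1 : u1 i - ∑ k, (g1 i k k - g1 k i k) = ∑ k, Z i k := by
      rw [hu1, ← Finset.sum_sub_distrib]
      refine Finset.sum_congr rfl fun k _ => ?_
      simp only [hZ, ← ht]
      ring
    -- Only the term `|b|²`, which has the favourable sign, is lost here.
    have e2 := normSq_sub_two_re_le (u1 i) (∑ k, (g1 i k k - g1 k i k))
    rw [e1] at e2
    have e3 := e2.trans (normSq_sum_le (Z i) hlam)
    have e4 : ∑ k, normSq (Z i k) / (lam i * lam k) = (∑ k, normSq (Z i k) / lam k) / lam i := by
      rw [Finset.sum_div]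
      exact Finset.sum_congr rfl fun k _ => by rw [div_div, mul_comm]
    rw [e4, div_mul_eq_mul_div, ← mul_div_assoc, ← sub_div]
    gcongr
    · exact (hlam i).le
    · linarith [mul_comm (∑ k, lam k) (∑ k, normSq (Z i k) / lam k)]
  -- termwise comparison of the third order terms
  have term : ∀ i k l, (if k = l then normSq (Z i k) / (lam i * lam k) else 0)
      - (B ^ 2 * (lam l * (lam i)⁻¹) + 4 * B ^ 2 * (lam i)⁻¹) ≤
      normSq (h1 k i l) / (lam i * lam l) - 2 * (conj (g1 i k l) * h1 i k l).re / lam i := by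
    intro i k l
    -- In the cross term the differentiation index carries the weight `1/λ_i`; in the square coming
    -- from the equation it is unweighted. Equality of the two torsions exchanges `i` and `k`, after
    -- which the weights match and the square can be completed.
    have e1 : h1 i k l = h1 k i l + (g1 i k l - g1 k i l) := by rw [← ht]; ring
    have e2 : ‖g1 i k l - g1 k i l‖ ≤ 2 * B := by
      refine (norm_sub_le _ _).trans ?_
      linarith [hg1 i k l, hg1 k i l]
    have e3 := normSq_div_sub_two_re_ge (h := h1 k i l) (hlam l) (hg1 i k l) e2
    rw [← e1] at e3
    have e4 := div_le_div_of_nonneg_right e3 (hlam i).le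
    have e5 : normSq (h1 k i l) / (lam i * lam l) - 2 * (conj (g1 i k l) * h1 i k l).re / lam i =
      (normSq (h1 k i l) / lam l - 2 * (conj (g1 i k l) * h1 i k l).re) / lam i := by
      rw [sub_div, div_div, mul_comm (lam l) (lam i)]
    rw [e5]
    refine le_trans ?_ e4
    rw [sub_div, div_div, mul_comm (lam l) (lam i)]
    refine sub_le_sub ?_ ?_
    · split_ifs with hkl
      · subst hkl; simp [hZ]
      · exact div_nonneg (normSq_nonneg _) (mul_pos (hlam _) (hlam _)).le
    · rw [div_eq_mul_inv]; exact le_of_eq (by ring)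
  have term' := Finset.sum_le_sum fun i (_ : i ∈ Finset.univ) =>
    Finset.sum_le_sum fun k (_ : k ∈ Finset.univ) =>
      Finset.sum_le_sum fun l (_ : l ∈ Finset.univ) => term i k l
  simp only [Finset.sum_sub_distrib, Finset.sum_add_distrib, ← Finset.mul_sum, Finset.sum_ite_eq,
    Finset.mem_univ, if_true, Finset.sum_const, Finset.card_univ, Fintype.card_fin, nsmul_eq_mul,
    ← Finset.sum_mul] at term'
  -- the fourth order terms
  have four : ∑ i, ∑ k, h2 i k / lam i =
      ∑ k, (F2 k + ∑ i, g2 k i - ∑ i, ∑ l, normSq (g1 k i l) +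
        ∑ i, ∑ l, normSq (h1 k i l) / (lam i * lam l)) +
      ∑ i, ∑ k, (g2 i k - g2 k i) / lam i := by
    have : ∀ k, F2 k + ∑ i, g2 k i - ∑ i, ∑ l, normSq (g1 k i l) +
        ∑ i, ∑ l, normSq (h1 k i l) / (lam i * lam l) = ∑ i, h2 k i / lam i := fun k => by
      rw [← hMA]; ring
    simp only [this]
    -- The equation controls `h2 k i / λ_i`, while the Laplacian of the trace contains `h2 i k /
    -- λ_i`. By `hs` they differ only by second derivatives of `g`.
    rw [Finset.sum_comm (f := fun k i => h2 k i / lam i), ← Finset.sum_add_distrib]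
    refine Finset.sum_congr rfl fun i _ => ?_
    rw [← Finset.sum_add_distrib]
    refine Finset.sum_congr rfl fun k _ => ?_
    rw [← hs]; ring
  have main : ∑ i, u2 i / lam i = ∑ i, ∑ k, h2 i k / lam i
      - ∑ i, ∑ k, ∑ l, 2 * (conj (g1 i k l) * h1 i k l).re / lam i
      + ∑ i, ∑ k, lam k * (lam i)⁻¹ * (∑ l, normSq (g1 i k l) + ∑ l, normSq (g1 i l k) - g2 i k)
      := by
    rw [← Finset.sum_sub_distrib, ← Finset.sum_add_distrib]
    refine Finset.sum_congr rfl fun i _ => ?_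
    rw [hu2, add_div, sub_div]
    simp only [Finset.sum_div]
    congr 1
    exact Finset.sum_congr rfl fun k _ => by rw [div_eq_mul_inv]; ring
  have swap : ∑ k, ∑ i, ∑ l, normSq (h1 k i l) / (lam i * lam l) =
      ∑ i, ∑ k, ∑ l, normSq (h1 k i l) / (lam i * lam l) := Finset.sum_comm
  -- The terms left over involve only the jets of `g`, hence are bounded by powers of `B` times `1`,
  -- `τ` or `u τ`.
  have b1 : -((n:ℝ) ^ 2 * B) ≤ ∑ k, ∑ i, g2 k i := by
    have : ∑ k : Fin n, ∑ i : Fin n, (-B) ≤ ∑ k, ∑ i, g2 k i :=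
      Finset.sum_le_sum fun k _ => Finset.sum_le_sum fun i _ => (abs_le.1 (hg2 k i)).1
    simp at this
    nlinarith
  have b2 : ∑ k, ∑ i, ∑ l, normSq (g1 k i l) ≤ (n:ℝ) ^ 3 * B ^ 2 := by
    have : ∑ k, ∑ i, ∑ l, normSq (g1 k i l) ≤ ∑ k : Fin n, ∑ i : Fin n, ∑ l : Fin n, B ^ 2 :=
      Finset.sum_le_sum fun k _ => Finset.sum_le_sum fun i _ => Finset.sum_le_sum fun l _ =>
        normSq_le_sq (hg1 k i l)
    simp at this
    nlinarith
  have b3 : -(2 * n * B * ∑ i, (lam i)⁻¹) ≤ ∑ i, ∑ k, (g2 i k - g2 k i) / lam i := by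
    have : ∑ i, ∑ k : Fin n, -(2 * B * (lam i)⁻¹) ≤ ∑ i, ∑ k, (g2 i k - g2 k i) / lam i := by
      refine Finset.sum_le_sum fun i _ => Finset.sum_le_sum fun k _ => ?_
      rw [div_eq_mul_inv, ← neg_mul]
      refine mul_le_mul_of_nonneg_right ?_ (inv_pos.2 (hlam i)).le
      linarith [(abs_le.1 (hg2 i k)).1, (abs_le.1 (hg2 k i)).2]
    simp only [Finset.sum_const, Finset.card_univ, Fintype.card_fin, nsmul_eq_mul,
      ← Finset.mul_sum, Finset.sum_neg_distrib, mul_neg] at this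
    linarith
  have b4 : -(B * (∑ i, lam i) * (∑ i, (lam i)⁻¹)) ≤
      ∑ i, ∑ k, lam k * (lam i)⁻¹ *
        (∑ l, normSq (g1 i k l) + ∑ l, normSq (g1 i l k) - g2 i k) := by
    have : ∑ i, ∑ k, lam k * (lam i)⁻¹ * (-B) ≤ ∑ i, ∑ k, lam k * (lam i)⁻¹ *
        (∑ l, normSq (g1 i k l) + ∑ l, normSq (g1 i l k) - g2 i k) := by
      refine Finset.sum_le_sum fun i _ => Finset.sum_le_sum fun k _ => ?_
      refine mul_le_mul_of_nonneg_left ?_ (mul_pos (hlam k) (inv_pos.2 (hlam i))).le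
      have p1 : 0 ≤ ∑ l, normSq (g1 i k l) := Finset.sum_nonneg fun _ _ => normSq_nonneg _
      have p2 : 0 ≤ ∑ l, normSq (g1 i l k) := Finset.sum_nonneg fun _ _ => normSq_nonneg _
      linarith [(abs_le.1 (hg2 i k)).2]
    simp only [← Finset.sum_mul, ← Finset.mul_sum] at this
    linarith
  rw [main, four]
  simp only [Finset.sum_add_distrib, Finset.sum_sub_distrib] at *
  rw [swap]
  linarith
/-- The constant in the lower bound for the Laplacian of `log tr_g g'`. -/
noncomputable def laplacianConst (n : ℕ) (B K : ℝ) : ℝ :=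
  (B + n * B ^ 2) + (2 * n * B + 4 * n ^ 2 * B ^ 2) * Real.exp K +
    (K + n ^ 2 * B + n ^ 3 * B ^ 2) * Real.exp K ^ 2

theorem laplacianConst_nonneg (n : ℕ) {B K : ℝ} (hB : 0 ≤ B) (hK : 0 ≤ K) :
    0 ≤ laplacianConst n B K := by
  unfold laplacianConst
  positivity

/-- If the sum were below `e^{-K} ≤ 1`, the product would be at most its `n`-th power, hence at most
the sum itself. Applied to `λ` and to `1/λ`, this keeps both `u` and `τ` away from zero. -/
theorem exp_neg_le_sum {n : ℕ} (hn : 0 < n) {x : Fin n → ℝ} (hx : ∀ i, 0 < x i) {K : ℝ}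
    (hK : 0 ≤ K) (hprod : Real.exp (-K) ≤ ∏ i, x i) : Real.exp (-K) ≤ ∑ i, x i := by
  by_contra! h
  have h1 : ∑ i, x i < 1 := h.trans_le (Real.exp_le_one_iff.2 (by linarith))
  have h0 : 0 ≤ ∑ i, x i := Finset.sum_nonneg fun i _ => (hx i).le
  have h2 : ∏ i, x i ≤ ∏ _i : Fin n, ∑ i, x i :=
    Finset.prod_le_prod (fun i _ => (hx i).le) fun i _ =>
      Finset.single_le_sum (fun j _ => (hx j).le) (Finset.mem_univ i)
  rw [Finset.prod_const, Finset.card_univ, Fintype.card_fin] at h2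
  have h3 : (∑ i, x i) ^ n ≤ ∑ i, x i := pow_le_of_le_one h0 h1.le hn.ne'
  linarith

/-- Each `x i` is the full product times the inverses of the other entries, and each of these
inverses is at most `T`. Using `1 + T ≥ 1` instead of `T` allows the exponent `n` in place of `n -
1`. -/
theorem sum_le_of_sum_inv_le {n : ℕ} {x : Fin n → ℝ} (hx : ∀ i, 0 < x i) {K T : ℝ}
    (hprod : ∏ i, x i ≤ Real.exp K) (hT : ∑ i, (x i)⁻¹ ≤ T) :
    ∑ i, x i ≤ n * (Real.exp K * (1 + T) ^ n) := by
  have hT0 : 0 ≤ T := (Finset.sum_nonneg fun i _ => (inv_pos.2 (hx i)).le).trans hT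
  have h : ∀ i, x i ≤ Real.exp K * (1 + T) ^ n := by
    intro i
    have e1 : x i = (∏ j, x j) * ∏ j ∈ Finset.univ.erase i, (x j)⁻¹ := by
      rw [← Finset.mul_prod_erase _ _ (Finset.mem_univ i), mul_assoc, ← Finset.prod_mul_distrib]
      simp [(hx _).ne']
    have e2 : ∏ j ∈ Finset.univ.erase i, (x j)⁻¹ ≤ ∏ j ∈ Finset.univ.erase i, (1 + T) :=
      Finset.prod_le_prod (fun j _ => (inv_pos.2 (hx j)).le) fun j _ =>
        ((Finset.single_le_sum (f := fun j => (x j)⁻¹) (fun j _ => (inv_pos.2 (hx j)).le)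
          (Finset.mem_univ j)).trans hT).trans (by linarith)
    have e3 : ∏ _j ∈ Finset.univ.erase i, (1 + T) ≤ (1 + T) ^ n := by
      rw [Finset.prod_const]
      refine pow_le_pow_right₀ (by linarith) ?_
      simp
    rw [e1]
    exact mul_le_mul hprod (e2.trans e3) (Finset.prod_nonneg fun j _ => (inv_pos.2 (hx j)).le)
      (Real.exp_pos _).le
  calc ∑ i, x i ≤ ∑ _i : Fin n, Real.exp K * (1 + T) ^ n := Finset.sum_le_sum fun i _ => h i
    _ = _ := by simp

/-- The maximum principle applied to `log u - A φ + r`, `r = 1 / (φ - inf φ + 1)`, on the level of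
jets. -/
theorem trace_le_of_jet {n : ℕ} (hn : 0 < n) {lam : Fin n → ℝ} (hlam : ∀ i, 0 < lam i)
    {g1 h1 : Fin n → Fin n → Fin n → ℂ} {g2 h2 : Fin n → Fin n → ℝ} {u1 : Fin n → ℂ}
    {u2 F2 : Fin n → ℝ} {B K : ℝ} (hB : 0 ≤ B) (hK : 0 ≤ K)
    (ht : ∀ i k l, h1 i k l - h1 k i l = g1 i k l - g1 k i l)
    (hs : ∀ i k, h2 i k - h2 k i = g2 i k - g2 k i)
    (hu1 : ∀ i, u1 i = ∑ k, (h1 i k k - g1 i k k * lam k))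
    (hu2 : ∀ i, u2 i = ∑ k, h2 i k - ∑ k, ∑ l, 2 * (conj (g1 i k l) * h1 i k l).re +
      ∑ k, lam k * (∑ l, normSq (g1 i k l) + ∑ l, normSq (g1 i l k) - g2 i k))
    (hMA : ∀ k, ∑ i, h2 k i / lam i - ∑ i, ∑ l, normSq (h1 k i l) / (lam i * lam l) =
      F2 k + ∑ i, g2 k i - ∑ i, ∑ l, normSq (g1 k i l))
    (hF : -K ≤ ∑ k, F2 k)
    (hg1 : ∀ i k l, ‖g1 i k l‖ ≤ B) (hg2 : ∀ i k, |g2 i k| ≤ B)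
    (hprod : ∏ i, lam i ≤ Real.exp K) (hprod' : Real.exp (-K) ≤ ∏ i, lam i)
    {A r : ℝ} (hA : A = laplacianConst n B K + 2) (hr : 0 < r) (hr1 : r ≤ 1) {p1 : Fin n → ℂ}
    (hcrit : ∀ i, u1 i / (∑ k, lam k : ℝ) = ((A + r ^ 2 : ℝ) : ℂ) * p1 i)
    (hmax : ∀ i, u2 i / (∑ k, lam k) - normSq (u1 i) / (∑ k, lam k) ^ 2 - A * (lam i - 1)
      + (2 * r ^ 3 * normSq (p1 i) - r ^ 2 * (lam i - 1)) ≤ 0) :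
    r ^ 3 * (∑ k, lam k) ^ 2 ≤ ((A + 1) * (2 * n * B)) ^ 2 ∨
      ∑ k, lam k ≤ n * (Real.exp K * (1 + (A + 1) * n) ^ n) := by
  -- When `r³ u²` is large the gradient term can be absorbed, and it then suffices to bound `τ` by
  -- `(A + 1) n`.
  rw [or_iff_not_imp_left, not_le]
  intro hbig
  refine sum_le_of_sum_inv_le hlam hprod ?_
  have : Nonempty (Fin n) := ⟨⟨0, hn⟩⟩
  have hmain := trace_jet_inequality hlam ht hs hu1 hu2 hMA hF hg1 hg2
  have hu0 : Real.exp (-K) ≤ ∑ k, lam k := exp_neg_le_sum hn hlam hK hprod'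
  have ht0 : Real.exp (-K) ≤ ∑ k, (lam k)⁻¹ := by
    refine exp_neg_le_sum hn (fun i => inv_pos.2 (hlam i)) hK ?_
    rw [Finset.prod_inv_distrib, Real.exp_neg]
    exact inv_anti₀ (Finset.prod_pos fun i _ => hlam i) hprod
  set b : Fin n → ℂ := fun i => ∑ k, (g1 i k k - g1 k i k) with hb
  have hbb : ∀ i, ‖b i‖ ≤ 2 * n * B := fun i => by
    calc ‖b i‖ ≤ ∑ k : Fin n, 2 * B := by
          refine norm_sum_le_of_le _ fun k _ => (norm_sub_le _ _).trans ?_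
          linarith [hg1 i k k, hg1 k i k]
      _ = 2 * n * B := by simp; ring
  set u := ∑ k, lam k with hu
  set τ := ∑ k, (lam k)⁻¹ with hτ
  have hE : Real.exp K * Real.exp (-K) = 1 := by rw [← Real.exp_add]; simp
  have hupos : 0 < u := (Real.exp_pos _).trans_le hu0
  have hτpos : 0 < τ := (Real.exp_pos _).trans_le ht0
  have hEpos := Real.exp_pos K
  have hA2 : 2 ≤ A := by rw [hA]; linarith [laplacianConst_nonneg n hB hK]
  have h1τ : 1 ≤ Real.exp K * τ := by
    calc (1 : ℝ) = Real.exp K * Real.exp (-K) := hE.symm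
      _ ≤ _ := by gcongr
  have h1u : u⁻¹ ≤ Real.exp K := by
    rw [inv_le_iff_one_le_mul₀ hupos]
    calc (1 : ℝ) = Real.exp K * Real.exp (-K) := hE.symm
      _ ≤ _ := by gcongr
  -- the gradient term
  have grad : ∀ i, 2 / u * ((u1 i / (u : ℝ)) * conj (b i)).re ≤ 2 * r ^ 3 * normSq (p1 i) + 1 / 2 := by
    intro i
    -- The critical point equation trades `∂u/u` for `∂φ`, with `A + r² ≤ A + 1`.
    have e1 : ((u1 i / (u : ℝ)) * conj (b i)).re ≤ (A + 1) * (‖p1 i‖ * (2 * n * B)) := by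
      rw [hcrit i]
      calc _ ≤ ‖((A + r ^ 2 : ℝ) : ℂ) * p1 i * conj (b i)‖ := re_le_norm _
        _ = (A + r ^ 2) * (‖p1 i‖ * ‖b i‖) := by
          rw [norm_mul, norm_mul, Complex.norm_real, Real.norm_of_nonneg (by positivity)]
          simp [mul_assoc]
        _ ≤ _ := by
          gcongr
          · nlinarith
          · exact hbb i
    set β := (A + 1) * (2 * n * B) with hβ
    have hβ0 : 0 ≤ β := by positivity
    have e2 : 2 / u * ((u1 i / (u : ℝ)) * conj (b i)).re ≤ 2 / u * (‖p1 i‖ * β) := by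
      refine mul_le_mul_of_nonneg_left (e1.trans (le_of_eq ?_)) (by positivity)
      rw [hβ]; ring
    refine e2.trans ?_
    rw [normSq_eq_norm_sq]
    have e3 : 0 < r ^ 3 := by positivity
    -- Completing the square in `|∂φ|` leaves half of this quotient; the largeness of `r³ u²` makes
    -- it at most `1/2`.
    have e4 : β ^ 2 / (r ^ 3 * u ^ 2) ≤ 1 := (div_le_one (by positivity)).2 hbig.le
    have e5 : 2 * r ^ 3 * ‖p1 i‖ ^ 2 + 1 / 2 * (β ^ 2 / (r ^ 3 * u ^ 2)) - 2 / u * (‖p1 i‖ * β)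
        = 2 * r ^ 3 * (‖p1 i‖ - β / (2 * r ^ 3 * u)) ^ 2 := by
      field_simp
      ring
    have e6 : 0 ≤ 2 * r ^ 3 * (‖p1 i‖ - β / (2 * r ^ 3 * u)) ^ 2 := by positivity
    linarith
  -- sum of the inequalities at the maximum point
  have hsum : ∑ i, (u2 i / u - normSq (u1 i) / u ^ 2 - A * (lam i - 1)
      + (2 * r ^ 3 * normSq (p1 i) - r ^ 2 * (lam i - 1))) / lam i ≤ 0 :=
    Finset.sum_nonpos fun i _ => div_nonpos_of_nonpos_of_nonneg (hmax i) (hlam i).le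
  have hgrad : ∑ i, (2 / u * ((u1 i / (u : ℝ)) * conj (b i)).re) / lam i ≤
      ∑ i, (2 * r ^ 3 * normSq (p1 i) + 1 / 2) / lam i :=
    Finset.sum_le_sum fun i _ => div_le_div_of_nonneg_right (grad i) (hlam i).le
  have s1 : ∑ i, (u2 i / u - normSq (u1 i) / u ^ 2 - A * (lam i - 1)
      + (2 * r ^ 3 * normSq (p1 i) - r ^ 2 * (lam i - 1))) / lam i =
      (∑ i, u2 i / lam i) / u - (∑ i, normSq (u1 i) / lam i) / u ^ 2 - (A + r ^ 2) * (n - τ)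
      + 2 * r ^ 3 * ∑ i, normSq (p1 i) / lam i := by
    have : (n : ℝ) - τ = ∑ i, (1 - (lam i)⁻¹) := by simp [hτ]
    rw [this, Finset.sum_div, Finset.sum_div, Finset.mul_sum, Finset.mul_sum,
      ← Finset.sum_sub_distrib, ← Finset.sum_sub_distrib, ← Finset.sum_add_distrib]
    refine Finset.sum_congr rfl fun i _ => ?_
    have := (hlam i).ne'
    field_simp
    ring
  have s2 : ∑ i, (2 / u * ((u1 i / (u : ℝ)) * conj (b i)).re) / lam i =
      (2 * ∑ i, (u1 i * conj (b i)).re / lam i) / u ^ 2 := by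
    rw [Finset.mul_sum, Finset.sum_div]
    refine Finset.sum_congr rfl fun i _ => ?_
    have := (hlam i).ne'
    have e : (u1 i / (u : ℝ)) * conj (b i) = (u1 i * conj (b i)) / (u : ℝ) := by ring
    rw [e, Complex.div_ofReal_re]
    field_simp
  have s3 : ∑ i, (2 * r ^ 3 * normSq (p1 i) + 1 / 2) / lam i =
      2 * r ^ 3 * ∑ i, normSq (p1 i) / lam i + τ / 2 := by
    rw [Finset.mul_sum, hτ, Finset.sum_div, ← Finset.sum_add_distrib]
    refine Finset.sum_congr rfl fun i _ => ?_
    have := (hlam i).ne'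
    field_simp
  rw [s1] at hsum
  rw [s2, s3] at hgrad
  have hdiv := div_le_div_of_nonneg_right hmain hupos.le
  have s4 : ((∑ i, normSq (u1 i) / lam i - 2 * ∑ i, (u1 i * conj (b i)).re / lam i) / u
      - (B + n * B ^ 2) * u * τ - (2 * n * B + 4 * n ^ 2 * B ^ 2) * τ
      - (K + n ^ 2 * B + n ^ 3 * B ^ 2)) / u =
      (∑ i, normSq (u1 i) / lam i) / u ^ 2 - (2 * ∑ i, (u1 i * conj (b i)).re / lam i) / u ^ 2
      - (B + n * B ^ 2) * τ - (2 * n * B + 4 * n ^ 2 * B ^ 2) * τ * u⁻¹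
      - (K + n ^ 2 * B + n ^ 3 * B ^ 2) * u⁻¹ := by
    field_simp
  rw [s4] at hdiv
  have c1 : (2 * n * B + 4 * n ^ 2 * B ^ 2) * τ * u⁻¹ ≤
      (2 * n * B + 4 * n ^ 2 * B ^ 2) * τ * Real.exp K := by gcongr
  -- A constant divided by `u` also becomes a multiple of `τ`: one factor `e^K` bounds `1/u`, the
  -- other comes from `1 ≤ e^K τ`.
  have c2 : (K + n ^ 2 * B + n ^ 3 * B ^ 2) * u⁻¹ ≤
      (K + n ^ 2 * B + n ^ 3 * B ^ 2) * (Real.exp K * (Real.exp K * τ)) := by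
    gcongr
    exact h1u.trans (le_mul_of_one_le_right hEpos.le h1τ)
  -- The terms `|∂u|²/u²` cancel, and so do the terms `2 r³ |∂φ|²`; the absorbed gradient term
  -- leaves `τ/2`.
  have c3 : (A + r ^ 2 - laplacianConst n B K - 1 / 2) * τ ≤ (A + r ^ 2) * n := by
    unfold laplacianConst
    linarith
  have c4 : r ^ 2 ≤ 1 := pow_le_one₀ hr.le hr1
  have c5 : (A + r ^ 2) * n ≤ (A + 1) * n := by gcongr
  have c6 : 1 * τ ≤ (A + r ^ 2 - laplacianConst n B K - 1 / 2) * τ := by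
    refine mul_le_mul_of_nonneg_right ?_ hτpos.le
    -- The summand `2` in `A` leaves a coefficient of at least `3/2` in front of `τ`.
    rw [hA]
    linarith [sq_nonneg r]
  linarith

end HermitianMA

/-! ### Exterior algebra: the top wedge power of a (1,1)-form as a determinant -/

namespace HermitianMA

theorem wedge_apply {n p q : ℕ} (α : CForm n p) (β : CForm n q) (v : Fin (p + q) → Cn n) :
    wedge α β v = ((p.factorial * q.factorial : ℂ)⁻¹) * ∑ σ : Equiv.Perm (Fin (p + q)),
      (σ.sign : ℂ) * (α (fun i => v (σ (Fin.castAdd q i))) * β (fun j => v (σ (Fin.natAdd p j)))) := by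
  rw [wedge, ContinuousAlternatingMap.smul_apply,
    ContinuousMultilinearMap.alternatization_apply_apply, Complex.real_smul]
  push_cast
  congr 1
  refine Finset.sum_congr rfl fun σ _ => ?_
  rw [Units.smul_def, zsmul_eq_mul]
  rfl

/-- The real covectors `dzⁱ` and `dz̄ⁱ` on `ℂⁿ`, with values in `ℂ`. -/
def covec {n : ℕ} : Fin n ⊕ Fin n → Cn n → ℂ
  | Sum.inl i => fun v => v i
  | Sum.inr i => fun v => conj (v i)

/-- The decomposable form with factors `covec (r a)`, evaluated on `v`. -/
def covecDet {n k : ℕ} (r : Fin k → Fin n ⊕ Fin n) (v : Fin k → Cn n) : ℂ :=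
  Matrix.det (Matrix.of fun a b => covec (r a) (v b))

theorem covecDet_eq_sum {n k : ℕ} (r : Fin k → Fin n ⊕ Fin n) (v : Fin k → Cn n) :
    covecDet r v = ∑ σ : Equiv.Perm (Fin k), (σ.sign : ℂ) * ∏ a, covec (r a) (v (σ a)) := by
  rw [covecDet, ← Matrix.det_transpose, Matrix.det_apply']
  rfl

/-- The Laplace expansion: the wedge product of decomposable forms. -/
theorem sum_perm_covecDet_mul {n p q : ℕ} (r : Fin p → Fin n ⊕ Fin n) (s : Fin q → Fin n ⊕ Fin n)
    (v : Fin (p + q) → Cn n) :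
    ∑ σ : Equiv.Perm (Fin (p + q)), (σ.sign : ℂ) *
      (covecDet r (fun i => v (σ (Fin.castAdd q i))) * covecDet s (fun j => v (σ (Fin.natAdd p j))))
      = (p.factorial * q.factorial : ℂ) * covecDet (Fin.append r s) v := by
  have key : ∀ (τ : Equiv.Perm (Fin p)) (ρ : Equiv.Perm (Fin q)),
      ∑ σ : Equiv.Perm (Fin (p + q)), (σ.sign : ℂ) *
        (((τ.sign : ℂ) * ∏ a, covec (r a) (v (σ (Fin.castAdd q (τ a))))) *
          ((ρ.sign : ℂ) * ∏ a, covec (s a) (v (σ (Fin.natAdd p (ρ a)))))) =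
        covecDet (Fin.append r s) v := by
    intro τ ρ
    -- `τ` and `ρ` form a block permutation `κ`, and the substitution `σ ↦ σ κ` removes them
    -- together with their signs. So all `p! q!` pairs contribute equally.
    set κ : Equiv.Perm (Fin (p + q)) := finSumFinEquiv.permCongr (Equiv.Perm.sumCongr τ ρ) with hκ
    have hs : κ.sign = τ.sign * ρ.sign := by
      rw [hκ, Equiv.Perm.sign_permCongr, Equiv.Perm.sign_sumCongr]
    have hl : ∀ a, κ (Fin.castAdd q a) = Fin.castAdd q (τ a) := fun a => by
      simp [hκ, Equiv.permCongr_apply]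
    have hr : ∀ a, κ (Fin.natAdd p a) = Fin.natAdd p (ρ a) := fun a => by
      simp [hκ, Equiv.permCongr_apply]
    rw [covecDet_eq_sum, ← Equiv.sum_comp (Equiv.mulRight κ) fun σ : Equiv.Perm (Fin (p + q)) =>
      (σ.sign : ℂ) * ∏ a, covec (Fin.append r s a) (v (σ a))]
    refine Finset.sum_congr rfl fun σ _ => ?_
    simp only [Equiv.coe_mulRight, Equiv.Perm.sign_mul, hs, Fin.prod_univ_add, Fin.append_left,
      Fin.append_right, Equiv.Perm.mul_apply, hl, hr]
    push_cast
    ring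
  calc _ = ∑ σ : Equiv.Perm (Fin (p + q)), ∑ τ : Equiv.Perm (Fin p), ∑ ρ : Equiv.Perm (Fin q),
        (σ.sign : ℂ) *
        (((τ.sign : ℂ) * ∏ a, covec (r a) (v (σ (Fin.castAdd q (τ a))))) *
          ((ρ.sign : ℂ) * ∏ a, covec (s a) (v (σ (Fin.natAdd p (ρ a)))))) := by
        refine Finset.sum_congr rfl fun σ _ => ?_
        rw [covecDet_eq_sum, covecDet_eq_sum, Finset.sum_mul_sum, Finset.mul_sum]
        exact Finset.sum_congr rfl fun τ _ => Finset.mul_sum _ _ _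
    _ = ∑ τ : Equiv.Perm (Fin p), ∑ ρ : Equiv.Perm (Fin q), covecDet (Fin.append r s) v := by
        rw [Finset.sum_comm]
        refine Finset.sum_congr rfl fun τ _ => ?_
        rw [Finset.sum_comm]
        exact Finset.sum_congr rfl fun ρ _ => key τ ρ
    _ = _ := by simp [Fintype.card_perm, mul_assoc]

theorem covecDet_one {n : ℕ} (r : Fin 1 → Fin n ⊕ Fin n) (v : Fin 1 → Cn n) :
    covecDet r v = covec (r 0) (v 0) := by
  simp [covecDet]

theorem formOfMatrix_apply {n : ℕ} (H : Matrix (Fin n) (Fin n) ℂ) (v : Fin 2 → Cn n) :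
    formOfMatrix H v =
      ∑ i, ∑ j, Complex.I * H i j * covecDet ![Sum.inl i, Sum.inr j] v := by
  have hw : ∀ i j, wedge (dz i) (dzbar j) v = covecDet ![Sum.inl i, Sum.inr j] v := by
    intro i j
    have h1 : ∀ w : Fin 1 → Cn n, dz i w = covecDet ![Sum.inl i] w := fun w => by
      rw [covecDet_one]; rfl
    have h2 : ∀ w : Fin 1 → Cn n, dzbar j w = covecDet ![Sum.inr j] w := fun w => by
      rw [covecDet_one]; rfl
    rw [wedge_apply]
    simp only [h1, h2]
    rw [sum_perm_covecDet_mul]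
    have : Fin.append ![(Sum.inl i : Fin n ⊕ Fin n)] ![Sum.inr j] = ![Sum.inl i, Sum.inr j] := by
      ext a; fin_cases a <;> rfl
    rw [this]
    simp
  simp only [formOfMatrix, ContinuousAlternatingMap.smul_apply, ContinuousAlternatingMap.sum_apply,
    hw, smul_eq_mul, Finset.mul_sum, mul_assoc]

/-- The factors `dz^{f 0}, dz̄^{g 0}, dz^{f 1}, dz̄^{g 1}, …`. -/
def interleave {n k : ℕ} (f g : Fin k → Fin n) (a : Fin (2 * k)) : Fin n ⊕ Fin n :=
  if a.1 % 2 = 0 then Sum.inl (f ⟨a.1 / 2, by omega⟩) else Sum.inr (g ⟨a.1 / 2, by omega⟩)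

theorem interleave_snoc {n k : ℕ} (f g : Fin k → Fin n) (i j : Fin n) :
    interleave (Fin.snoc (α := fun _ => Fin n) f i) (Fin.snoc (α := fun _ => Fin n) g j) =
      Fin.append (interleave f g) ![Sum.inl i, Sum.inr j] := by
  ext1 a
  refine Fin.addCases (m := 2 * k) (n := 2) (fun b => ?_) (fun b => ?_) a
  · rw [Fin.append_left]
    have hb : b.1 / 2 < k := by omega
    simp [interleave, Fin.snoc, hb]
  · rw [Fin.append_right]
    fin_cases b
    · simp [interleave, Fin.snoc]
    · have h1 : (2 * k + 1) % 2 = 1 := by omega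
      have h2 : (2 * k + 1) / 2 = k := by omega
      simp [interleave, Fin.snoc, h1, h2]

/-- Multilinear expansion, keeping the order `dz ∧ dz̄ ∧ dz ∧ dz̄ ∧ ⋯` in which the factors appear.
No reordering is needed, so no signs arise; the induction step is the Laplace expansion applied to
each term. -/
theorem wedgePow_formOfMatrix_apply {n : ℕ} (H : Matrix (Fin n) (Fin n) ℂ) (k : ℕ)
    (v : Fin (2 * k) → Cn n) :
    wedgePow (formOfMatrix H) k v =
      ∑ f : Fin k → Fin n, ∑ g : Fin k → Fin n,
        (∏ a, Complex.I * H (f a) (g a)) * covecDet (interleave f g) v := by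
  induction k with
  | zero => simp [wedgePow, covecDet, Matrix.det_isEmpty]
  | succ k ih =>
    have hsum : ∀ c : (Fin (k + 1) → Fin n) → ℂ,
        ∑ f, c f = ∑ f : Fin k → Fin n, ∑ i, c (Fin.snoc (α := fun _ => Fin n) f i) := by
      intro c
      rw [← (Fin.snocEquiv fun _ => Fin n).sum_comp, Fintype.sum_prod_type, Finset.sum_comm]
      rfl
    have hdef : wedgePow (formOfMatrix H) (k + 1) v =
      wedge (wedgePow (formOfMatrix H) k) (formOfMatrix H) v := rfl
    rw [hdef, wedge_apply]
    simp only [ih, formOfMatrix_apply]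
    rw [hsum]
    simp only [hsum (fun g => _ * _), Fin.prod_univ_castSucc, Fin.snoc_castSucc, Fin.snoc_last,
      interleave_snoc]
    have hL : ∀ (f g : Fin k → Fin n) (i j : Fin n),
        (∏ a, Complex.I * H (f a) (g a)) * (Complex.I * H i j) *
          covecDet (Fin.append (interleave f g) ![Sum.inl i, Sum.inr j]) v =
        (((2 * k).factorial * (2 : ℕ).factorial : ℂ)⁻¹) * ∑ σ : Equiv.Perm (Fin (2 * k + 2)),
          (σ.sign : ℂ) * ((∏ a, Complex.I * H (f a) (g a)) *
            covecDet (interleave f g) (fun i => v (σ (Fin.castAdd 2 i))) *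
            (Complex.I * H i j *
              covecDet ![Sum.inl i, Sum.inr j] (fun j => v (σ (Fin.natAdd (2 * k) j))))) := by
      intro f g i j
      have hL := sum_perm_covecDet_mul (interleave f g) ![Sum.inl i, Sum.inr j] v
      have hne : ((2 * k).factorial * (2 : ℕ).factorial : ℂ) ≠ 0 := by
        exact_mod_cast (mul_pos (Nat.factorial_pos _) (Nat.factorial_pos _)).ne'
      rw [eq_inv_mul_iff_mul_eq₀ hne, mul_left_comm, ← hL, Finset.mul_sum]
      exact Finset.sum_congr rfl fun σ _ => by ring
    calc _ = ∑ f : Fin k → Fin n, ∑ g : Fin k → Fin n, ∑ i, ∑ j,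
        (((2 * k).factorial * (2 : ℕ).factorial : ℂ)⁻¹) * ∑ σ : Equiv.Perm (Fin (2 * k + 2)),
          (σ.sign : ℂ) * ((∏ a, Complex.I * H (f a) (g a)) *
            covecDet (interleave f g) (fun i => v (σ (Fin.castAdd 2 i))) *
            (Complex.I * H i j *
              covecDet ![Sum.inl i, Sum.inr j] (fun j => v (σ (Fin.natAdd (2 * k) j))))) := by
          simp only [← Finset.mul_sum]
          congr 1
          simp only [Finset.sum_comm (t := (Finset.univ : Finset (Equiv.Perm (Fin (2 * k + 2)))))]
          refine Finset.sum_congr rfl fun σ _ => ?_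
          simp only [← Finset.mul_sum]
          congr 1
          simp only [Finset.sum_mul]
      _ = _ := by
          refine Finset.sum_congr rfl fun f _ => ?_
          rw [Finset.sum_comm]
          refine Finset.sum_congr rfl fun i _ => ?_
          refine Finset.sum_congr rfl fun g _ => ?_
          refine Finset.sum_congr rfl fun j _ => (hL f g i j).symm

/-- The bijection `j ↦ 2 j`, `j ↦ 2 j + 1`. -/
def interleaveEquiv (n : ℕ) : Fin n ⊕ Fin n ≃ Fin (2 * n) where
  toFun := Sum.elim (fun j => ⟨2 * j.1, by omega⟩) (fun j => ⟨2 * j.1 + 1, by omega⟩)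
  invFun a := if a.1 % 2 = 0 then Sum.inl ⟨a.1 / 2, by omega⟩ else Sum.inr ⟨a.1 / 2, by omega⟩
  left_inv := by
    rintro (j | j)
    · simp
    · have h1 : (2 * j.1 + 1) % 2 = 1 := by omega
      have h2 : (2 * j.1 + 1) / 2 = j.1 := by omega
      simp [h1, h2]
  right_inv a := by
    by_cases h : a.1 % 2 = 0
    · simp only [h, if_true, Sum.elim_inl]
      exact Fin.ext (by simp; omega)
    · simp only [h, if_false, Sum.elim_inr]
      exact Fin.ext (by simp; omega)

theorem interleave_equiv {n k : ℕ} (f g : Fin k → Fin n) (a : Fin k ⊕ Fin k) :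
    interleave f g (interleaveEquiv k a) = Sum.map f g a := by
  rcases a with j | j
  · simp [interleave, interleaveEquiv]
  · have h1 : (2 * j.1 + 1) % 2 = 1 := by omega
    have h2 : (2 * j.1 + 1) / 2 = j.1 := by omega
    simp [interleave, interleaveEquiv, h1, h2]

/-- The standard real basis `e₁, √-1 e₁, e₂, √-1 e₂, …` of `ℂⁿ`. -/
def stdFrame (n : ℕ) (a : Fin (2 * n)) : Cn n :=
  Sum.elim (fun j => Pi.single j 1) (fun j => Pi.single j Complex.I) ((interleaveEquiv n).symm a)

/-- Reindexing rows and columns by the same bijection separates `dz` from `dz̄` and `e_j` from `√-1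
e_j` without changing the determinant. The choice of `f` and `g` then only selects rows of one fixed
block matrix. -/
theorem covecDet_interleave_stdFrame {n : ℕ} (f g : Fin n → Fin n) :
    covecDet (interleave f g) (stdFrame n) =
      ((Matrix.fromBlocks 1 (Complex.I • 1) 1 (-Complex.I • 1) :
        Matrix (Fin n ⊕ Fin n) (Fin n ⊕ Fin n) ℂ).submatrix (Sum.map f g) id).det := by
  rw [covecDet, ← Matrix.det_submatrix_equiv_self (interleaveEquiv n)]
  congr 1
  ext a b
  rw [Matrix.submatrix_apply, Matrix.of_apply, interleave_equiv]
  rcases a with a | a <;> rcases b with b | b <;>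
    simp [stdFrame, covec, Pi.single_apply, Matrix.one_apply, apply_ite (conj : ℂ → ℂ),
      apply_ite (Neg.neg : ℂ → ℂ)]

/-- A repeated index gives two equal rows, so only permutations `σ`, `τ` survive, each contributing
the factor `sgn σ sgn τ det T`. For fixed `τ` the sum over `σ` is `det H`, the two signs of `τ`
cancelling, and the `n!` choices of `τ` agree. Only the nonvanishing of the factor of `det H`
matters later. -/
theorem wedgePow_formOfMatrix_stdFrame {n : ℕ} (H : Matrix (Fin n) (Fin n) ℂ) :
    wedgePow (formOfMatrix H) n (stdFrame n) =
      Complex.I ^ n * n.factorial * (-2 * Complex.I) ^ n * H.det := by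
  set T : Matrix (Fin n ⊕ Fin n) (Fin n ⊕ Fin n) ℂ :=
    Matrix.fromBlocks 1 (Complex.I • 1) 1 (-Complex.I • 1) with hT
  have hdet : T.det = (-2 * Complex.I) ^ n := by
    have h1 : (-Complex.I • 1 - 1 * Complex.I • 1 : Matrix (Fin n) (Fin n) ℂ) =
        (-2 * Complex.I) • 1 := by
      rw [one_mul, ← sub_smul]; congr 1; ring
    rw [hT, Matrix.det_fromBlocks_one₁₁, h1, Matrix.det_smul, Matrix.det_one]
    simp
  have hf : ∀ f g : Fin n → Fin n, ¬ Injective f → covecDet (interleave f g) (stdFrame n) = 0 := by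
    intro f g hf
    obtain ⟨a, b, hab, hne⟩ : ∃ a b, f a = f b ∧ a ≠ b := by simpa [Injective] using hf
    rw [covecDet_interleave_stdFrame]
    refine Matrix.det_zero_of_row_eq (i := Sum.inl a) (j := Sum.inl b) (by simpa using hne) ?_
    ext c
    simp [hab]
  have hg : ∀ f g : Fin n → Fin n, ¬ Injective g → covecDet (interleave f g) (stdFrame n) = 0 := by
    intro f g hf
    obtain ⟨a, b, hab, hne⟩ : ∃ a b, g a = g b ∧ a ≠ b := by simpa [Injective] using hf
    rw [covecDet_interleave_stdFrame]
    refine Matrix.det_zero_of_row_eq (i := Sum.inr a) (j := Sum.inr b) (by simpa using hne) ?_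
    ext c
    simp [hab]
  have hp : ∀ σ τ : Equiv.Perm (Fin n), covecDet (interleave σ τ) (stdFrame n) =
      (σ.sign : ℂ) * (τ.sign : ℂ) * T.det := by
    intro σ τ
    rw [covecDet_interleave_stdFrame]
    have := Matrix.det_permute (Equiv.Perm.sumCongr σ τ) T
    rw [Equiv.Perm.sign_sumCongr] at this
    push_cast at this
    rw [← this]
    rfl
  have hsum : ∀ c : (Fin n → Fin n) → ℂ, (∀ f, ¬ Injective f → c f = 0) →
      ∑ f, c f = ∑ σ : Equiv.Perm (Fin n), c σ := by
    intro c hc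
    symm
    refine Finset.sum_bij_ne_zero (fun σ _ _ => (σ : Fin n → Fin n)) (fun _ _ _ => Finset.mem_univ _)
      (fun σ _ _ τ _ _ h => Equiv.ext (congrFun h)) (fun f _ hne => ?_) (fun _ _ _ => rfl)
    have hinj : Injective f := by by_contra h; exact hne (hc f h)
    exact ⟨Equiv.ofBijective f (Finite.injective_iff_bijective.1 hinj), Finset.mem_univ _, hne, rfl⟩
  rw [wedgePow_formOfMatrix_apply, Finset.sum_comm, hsum _ fun g h => Finset.sum_eq_zero fun f _ => by
    rw [hg f g h, mul_zero]]
  have hτ : ∀ τ : Equiv.Perm (Fin n), ∑ f : Fin n → Fin n,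
      (∏ a, Complex.I * H (f a) (τ a)) * covecDet (interleave f τ) (stdFrame n) =
      Complex.I ^ n * T.det * H.det := by
    intro τ
    rw [hsum _ fun f h => by rw [hf f τ h, mul_zero]]
    have h1 : (H.submatrix id τ).det = (τ.sign : ℂ) * H.det := Matrix.det_permute' τ H
    have h2 : (τ.sign : ℂ) * (τ.sign : ℂ) = 1 := by
      rw [← Int.cast_mul, Int.units_coe_mul_self, Int.cast_one]
    calc _ = Complex.I ^ n * T.det * ((τ.sign : ℂ) * (H.submatrix id τ).det) := by
          rw [Matrix.det_apply' (H.submatrix id τ), Finset.mul_sum, Finset.mul_sum]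
          refine Finset.sum_congr rfl fun σ _ => ?_
          rw [hp, Finset.prod_mul_distrib]
          simp
          ring
      _ = _ := by rw [h1, ← mul_assoc (τ.sign : ℂ), h2, one_mul]
  simp only [hτ]
  rw [hdet]
  simp [Fintype.card_perm]
  ring

/-- The Monge–Ampère equation in terms of determinants. -/
theorem det_eq_of_wedgePow_eq {n : ℕ} {H G : Matrix (Fin n) (Fin n) ℂ} {c : ℂ}
    (h : wedgePow (formOfMatrix H) n = c • wedgePow (formOfMatrix G) n) : H.det = c * G.det := by
  have h1 := congrArg (fun α : CForm n (2 * n) => α (stdFrame n)) h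
  simp only [ContinuousAlternatingMap.smul_apply, wedgePow_formOfMatrix_stdFrame, smul_eq_mul] at h1
  have hne : Complex.I ^ n * n.factorial * (-2 * Complex.I) ^ n ≠ 0 := by
    simp [Nat.factorial_ne_zero]
  refine mul_left_cancel₀ hne ?_
  rw [h1]
  ring

end HermitianMA

/-! ### Wirtinger derivatives along constant vectors and the maximum principle -/

namespace HermitianMA

open Complex

/-- The derivative `½ (∂_v f + s ∂_{√-1 v} f)`: for `s = -√-1` this is `∂_v f`, and for `s = √-1` it
is `∂̄_v f`. -/
noncomputable def wirt {n : ℕ} (s : ℂ) (v : Cn n) (f : Cn n → ℂ) (z : Cn n) : ℂ :=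
  (1 / 2) * (fderiv ℝ f z v + s * fderiv ℝ f z (I • v))

variable {n : ℕ}

theorem I_smul_single (i : Fin n) : (I • Pi.single i 1 : Cn n) = Pi.single i I := by
  ext j; by_cases h : j = i
  · subst h; simp
  · simp [h]

theorem dWirt_eq_wirt (i : Fin n) (f : Cn n → ℂ) : dWirt i f = wirt (-I) (Pi.single i 1) f := by
  ext z; rw [dWirt, wirt, I_smul_single]; ring

theorem dbarWirt_eq_wirt (i : Fin n) (f : Cn n → ℂ) : dbarWirt i f = wirt I (Pi.single i 1) f := by
  ext z; rw [dbarWirt, wirt, I_smul_single]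

theorem wirt_vec_add (s : ℂ) (v w : Cn n) (f : Cn n → ℂ) (z : Cn n) :
    wirt s (v + w) f z = wirt s v f z + wirt s w f z := by
  simp only [wirt, smul_add, map_add]; ring

theorem fderiv_smul_complex (f : Cn n → ℂ) (z v : Cn n) (c : ℂ) :
    fderiv ℝ f z (c • v) = c.re * fderiv ℝ f z v + c.im * fderiv ℝ f z (I • v) := by
  have : c • v = c.re • v + c.im • (I • v) := by
    ext i
    simp only [Pi.smul_apply, Pi.add_apply, smul_eq_mul, real_smul]
    conv_lhs => rw [← re_add_im c]
    ring
  rw [this, map_add, map_smul, map_smul, real_smul, real_smul]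

/-- Together with `wirt_I_smul`: `∂_v` is complex linear in `v` and `∂̄_v` conjugate linear.
Derivatives in a constant frame are therefore constant combinations of coordinate derivatives. -/
theorem wirt_neg_I_smul (c : ℂ) (v : Cn n) (f : Cn n → ℂ) (z : Cn n) :
    wirt (-I) (c • v) f z = c * wirt (-I) v f z := by
  rw [wirt, wirt, smul_smul, fderiv_smul_complex f z v c, fderiv_smul_complex f z v (I * c)]
  simp only [mul_re, I_re, zero_mul, I_im, one_mul, zero_sub, mul_im, zero_add]
  conv_rhs => rw [← re_add_im c]
  push_cast
  linear_combination (1 / 2 * c.im * fderiv ℝ f z (I • v)) * I_sq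

theorem wirt_I_smul (c : ℂ) (v : Cn n) (f : Cn n → ℂ) (z : Cn n) :
    wirt I (c • v) f z = conj c * wirt I v f z := by
  have hc : conj c = c.re - c.im * I := by
    apply Complex.ext <;> simp
  rw [wirt, wirt, smul_smul, fderiv_smul_complex f z v c, fderiv_smul_complex f z v (I * c), hc]
  simp only [mul_re, I_re, zero_mul, I_im, one_mul, zero_sub, mul_im, zero_add]
  push_cast
  linear_combination (1 / 2 * c.im * fderiv ℝ f z (I • v)) * I_sq

theorem wirt_vec_zero (s : ℂ) (f : Cn n → ℂ) (z : Cn n) : wirt s 0 f z = 0 := by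
  simp [wirt]

theorem wirt_vec_sum {ι : Type*} (t : Finset ι) (s : ℂ) (v : ι → Cn n) (f : Cn n → ℂ) (z : Cn n) :
    wirt s (∑ a ∈ t, v a) f z = ∑ a ∈ t, wirt s (v a) f z := by
  classical
  induction t using Finset.induction_on with
  | empty => simp [wirt_vec_zero]
  | insert a t ha ih => rw [Finset.sum_insert ha, Finset.sum_insert ha, wirt_vec_add, ih]

theorem eq_sum_single (v : Cn n) : v = ∑ a, v a • (Pi.single a 1 : Cn n) := by
  ext b
  simp [Finset.sum_apply, Pi.single_apply]

theorem wirt_neg_I_eq_sum (v : Cn n) (f : Cn n → ℂ) (z : Cn n) :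
    wirt (-I) v f z = ∑ a, v a * wirt (-I) (Pi.single a 1) f z := by
  conv_lhs => rw [eq_sum_single v, wirt_vec_sum]
  simp only [wirt_neg_I_smul]

theorem wirt_I_eq_sum (v : Cn n) (f : Cn n → ℂ) (z : Cn n) :
    wirt I v f z = ∑ a, conj (v a) * wirt I (Pi.single a 1) f z := by
  conv_lhs => rw [eq_sum_single v, wirt_vec_sum]
  simp only [wirt_I_smul]

section Calculus

variable {s : ℂ} {v : Cn n} {f g : Cn n → ℂ} {z : Cn n} {U : Set (Cn n)}

theorem wirt_congr_nhds (h : f =ᶠ[nhds z] g) : wirt s v f z = wirt s v g z := by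
  rw [wirt, wirt, h.fderiv_eq]

theorem wirt_congr (hU : IsOpen U) (hz : z ∈ U) (h : EqOn f g U) :
    wirt s v f z = wirt s v g z :=
  wirt_congr_nhds (h.eventuallyEq_of_mem (hU.mem_nhds hz))

theorem wirt_const (c : ℂ) : wirt s v (fun _ => c) z = 0 := by
  simp [wirt]

theorem wirt_add (hf : DifferentiableAt ℝ f z) (hg : DifferentiableAt ℝ g z) :
    wirt s v (fun w => f w + g w) z = wirt s v f z + wirt s v g z := by
  simp only [wirt, fderiv_fun_add hf hg, add_apply]; ring

theorem wirt_sub (hf : DifferentiableAt ℝ f z) (hg : DifferentiableAt ℝ g z) :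
    wirt s v (fun w => f w - g w) z = wirt s v f z - wirt s v g z := by
  simp only [wirt, fderiv_fun_sub hf hg, sub_apply]; ring

theorem wirt_mul (hf : DifferentiableAt ℝ f z) (hg : DifferentiableAt ℝ g z) :
    wirt s v (fun w => f w * g w) z = wirt s v f z * g z + f z * wirt s v g z := by
  simp only [wirt, fderiv_fun_mul hf hg, add_apply, smul_apply, smul_eq_mul]; ring

theorem wirt_const_mul (c : ℂ) (hf : DifferentiableAt ℝ f z) :
    wirt s v (fun w => c * f w) z = c * wirt s v f z := by
  rw [wirt_mul (differentiableAt_const c) hf, wirt_const]; ring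

theorem wirt_sum {ι : Type*} (t : Finset ι) {f : ι → Cn n → ℂ}
    (hf : ∀ a ∈ t, DifferentiableAt ℝ (f a) z) :
    wirt s v (fun w => ∑ a ∈ t, f a w) z = ∑ a ∈ t, wirt s v (f a) z := by
  simp only [wirt, fderiv_fun_sum hf, sum_apply, Finset.mul_sum, ← Finset.sum_add_distrib]

theorem wirt_prod {ι : Type*} [DecidableEq ι] (t : Finset ι) {f : ι → Cn n → ℂ}
    (hf : ∀ a ∈ t, DifferentiableAt ℝ (f a) z) :
    wirt s v (fun w => ∏ a ∈ t, f a w) z =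
      ∑ a ∈ t, (∏ b ∈ t.erase a, f b z) * wirt s v (f a) z := by
  have h := (HasFDerivAt.finsetProd (u := t) fun a ha => (hf a ha).hasFDerivAt).fderiv
  have h' : fderiv ℝ (fun w => ∏ a ∈ t, f a w) z =
      ∑ i ∈ t, (∏ j ∈ t.erase i, f j z) • fderiv ℝ (f i) z := by
    rw [← h]
  simp only [wirt, h', sum_apply, smul_apply, smul_eq_mul, Finset.mul_sum,
    ← Finset.sum_add_distrib]
  exact Finset.sum_congr rfl fun a _ => by ring

theorem wirt_exp (hf : DifferentiableAt ℝ f z) :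
    wirt s v (fun w => exp (f w)) z = exp (f z) * wirt s v f z := by
  have h : HasFDerivAt (fun w => exp (f w)) (exp (f z) • fderiv ℝ f z) z := hf.hasFDerivAt.cexp
  simp only [wirt, h.fderiv, smul_apply, smul_eq_mul]; ring

theorem conj_wirt (hf : DifferentiableAt ℝ f z) :
    conj (wirt s v f z) = wirt (conj s) v (fun w => conj (f w)) z := by
  have h : fderiv ℝ (fun w => conj (f w)) z = (conjCLE : ℂ →L[ℝ] ℂ).comp (fderiv ℝ f z) :=
    (conjCLE.toContinuousLinearMap.hasFDerivAt.comp z hf.hasFDerivAt).fderiv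
  simp [wirt, h, -one_div, -map_inv₀, Complex.conj_ofNat]

theorem wirt_contDiffOn (hU : IsOpen U) (hf : ContDiffOn ℝ ∞ f U) (s : ℂ) (v : Cn n) :
    ContDiffOn ℝ ∞ (wirt s v f) U := by
  have h : ContDiffOn ℝ ∞ (fderiv ℝ f) U := hf.fderiv_of_isOpen hU (by simp)
  unfold wirt
  exact contDiffOn_const.mul ((h.clm_apply contDiffOn_const).add
    (contDiffOn_const.mul (h.clm_apply contDiffOn_const)))

theorem differentiableAt_of_contDiffOn {E : Type*} [NormedAddCommGroup E] [NormedSpace ℝ E]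
    {f : Cn n → E} (hU : IsOpen U) (hf : ContDiffOn ℝ ∞ f U) (hz : z ∈ U) :
    DifferentiableAt ℝ f z :=
  (hf.contDiffAt (hU.mem_nhds hz)).differentiableAt (by simp)

theorem fderiv_wirt_apply (hU : IsOpen U) (hf : ContDiffOn ℝ ∞ f U) (hz : z ∈ U) (s : ℂ)
    (v w : Cn n) :
    fderiv ℝ (wirt s v f) z w =
      (1 / 2) * (fderiv ℝ (fderiv ℝ f) z w v + s * fderiv ℝ (fderiv ℝ f) z w (I • v)) := by
  have h : ContDiffOn ℝ ∞ (fderiv ℝ f) U := hf.fderiv_of_isOpen hU (by simp)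
  have hd := (differentiableAt_of_contDiffOn hU h hz).hasFDerivAt
  have h1 : ∀ u : Cn n, HasFDerivAt (fun y => fderiv ℝ f y u) ((fderiv ℝ (fderiv ℝ f) z).flip u) z :=
    fun u => by simpa using hd.clm_apply (hasFDerivAt_const u z)
  have h2 := ((h1 v).add ((h1 (I • v)).const_mul s)).const_mul (1 / 2 : ℂ)
  have h3 : fderiv ℝ (wirt s v f) z = _ := h2.fderiv
  rw [h3]
  simp [mul_add]

/-- The vectors are constant, so this is the symmetry of the second real derivative. -/
theorem wirt_comm (hU : IsOpen U) (hf : ContDiffOn ℝ ∞ f U) (hz : z ∈ U) (s s' : ℂ) (v w : Cn n) :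
    wirt s v (wirt s' w f) z = wirt s' w (wirt s v f) z := by
  have hsymm : IsSymmSndFDerivAt ℝ f z :=
    (hf.contDiffAt (hU.mem_nhds hz)).isSymmSndFDerivAt
      (by rw [minSmoothness_of_isRCLikeNormedField]; exact ENat.LEInfty.out)
  rw [wirt, wirt]
  simp only [fderiv_wirt_apply hU hf hz]
  rw [hsymm.eq v w, hsymm.eq v (I • w), hsymm.eq (I • v) w, hsymm.eq (I • v) (I • w)]
  ring

end Calculus

section Max

variable {Q : Cn n → ℝ} {z : Cn n} {U : Set (Cn n)}

theorem fderiv_ofReal_comp (hQ : DifferentiableAt ℝ Q z) (v : Cn n) :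
    fderiv ℝ (fun w => (Q w : ℂ)) z v = (fderiv ℝ Q z v : ℂ) := by
  have h : HasFDerivAt (fun w => (Q w : ℂ)) (ofRealCLM.comp (fderiv ℝ Q z)) z :=
    ofRealCLM.hasFDerivAt.comp z hQ.hasFDerivAt
  rw [h.fderiv]; rfl

theorem wirt_eq_zero_of_isLocalMax (hQ : DifferentiableAt ℝ Q z) (hmax : IsLocalMax Q z) (s : ℂ)
    (v : Cn n) : wirt s v (fun w => (Q w : ℂ)) z = 0 := by
  simp [wirt, fderiv_ofReal_comp hQ, hmax.fderiv_eq_zero]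

/-- A positive second derivative would make the point a local minimum as well, hence `q` locally
constant, a contradiction. -/
theorem deriv_deriv_nonpos_of_isLocalMax {q : ℝ → ℝ} {t : ℝ} (hq : ContinuousAt q t)
    (hmax : IsLocalMax q t) : deriv (deriv q) t ≤ 0 := by
  by_contra! h
  have hd : deriv q t = 0 := hmax.deriv_eq_zero
  have hmin := isLocalMin_of_deriv_deriv_pos h hd hq
  have hconst : q =ᶠ[nhds t] fun _ => q t := by
    filter_upwards [hmax, hmin] with x h1 h2 using le_antisymm h1 h2
  have h2 : deriv q =ᶠ[nhds t] fun _ => 0 := by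
    filter_upwards [hconst.eventuallyEq_nhds] with x hx
    rw [hx.deriv_eq]; simp
  rw [h2.deriv_eq] at h
  simp at h

theorem snd_fderiv_nonpos_of_isLocalMax (hU : IsOpen U) (hQ : ContDiffOn ℝ ∞ Q U) (hz : z ∈ U)
    (hmax : IsLocalMax Q z) (v : Cn n) : fderiv ℝ (fderiv ℝ Q) z v v ≤ 0 := by
  have hline : ∀ t : ℝ, HasDerivAt (fun t : ℝ => z + t • v) v t := fun t => by
    simpa using ((hasDerivAt_id t).smul_const v).const_add z
  have h0 : z + (0 : ℝ) • v = z := by simp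
  have hcont : ContinuousAt (fun t : ℝ => z + t • v) 0 := (hline 0).continuousAt
  have hmem : ∀ᶠ t : ℝ in nhds 0, z + t • v ∈ U :=
    hcont.eventually_mem (by rw [h0]; exact hU.mem_nhds hz)
  have hd : deriv (fun t : ℝ => Q (z + t • v)) =ᶠ[nhds 0] fun t => fderiv ℝ Q (z + t • v) v := by
    filter_upwards [hmem] with t ht
    exact ((differentiableAt_of_contDiffOn hU hQ ht).hasFDerivAt.comp_hasDerivAt t (hline t)).deriv
  have h1 : ContDiffOn ℝ ∞ (fderiv ℝ Q) U := hQ.fderiv_of_isOpen hU (by simp)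
  have hdd : deriv (deriv fun t : ℝ => Q (z + t • v)) 0 = fderiv ℝ (fderiv ℝ Q) z v v := by
    rw [hd.deriv_eq]
    have h2 : HasFDerivAt (fun y => fderiv ℝ Q y v) ((fderiv ℝ (fderiv ℝ Q) z).flip v)
        (z + (0 : ℝ) • v) := by
      rw [h0]
      simpa using (differentiableAt_of_contDiffOn hU h1 hz).hasFDerivAt.clm_apply
        (hasFDerivAt_const v z)
    exact (h2.comp_hasDerivAt (0 : ℝ) (hline 0)).deriv
  rw [← hdd]
  refine deriv_deriv_nonpos_of_isLocalMax ?_ ?_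
  · refine ContinuousAt.comp (g := Q) ?_ hcont
    rw [h0]; exact (differentiableAt_of_contDiffOn hU hQ hz).continuousAt
  · have := hcont.tendsto
    rw [h0] at this
    have h4 : ∀ᶠ t : ℝ in nhds 0, Q (z + t • v) ≤ Q z := this.eventually hmax
    simpa [IsLocalMax, IsMaxFilter] using h4

/-- `∂_v ∂̄_v Q` is a quarter of the sum of the second real derivatives along `v` and `√-1 v`; the
mixed terms cancel by symmetry. -/
theorem wirt_wirt_nonpos_of_isLocalMax (hU : IsOpen U) (hQ : ContDiffOn ℝ ∞ Q U) (hz : z ∈ U)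
    (hmax : IsLocalMax Q z) (v : Cn n) :
    (wirt (-I) v (wirt I v fun w => (Q w : ℂ)) z).re ≤ 0 := by
  have hQc : ContDiffOn ℝ ∞ (fun w => (Q w : ℂ)) U := ofRealCLM.contDiff.comp_contDiffOn hQ
  have h1 : ContDiffOn ℝ ∞ (fderiv ℝ Q) U := hQ.fderiv_of_isOpen hU (by simp)
  have hdd : ∀ a b : Cn n, fderiv ℝ (fderiv ℝ fun w => (Q w : ℂ)) z a b =
      (fderiv ℝ (fderiv ℝ Q) z a b : ℂ) := by
    intro a b
    have e1 : (fderiv ℝ fun w => (Q w : ℂ)) =ᶠ[nhds z] fun y => ofRealCLM.comp (fderiv ℝ Q y) := by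
      filter_upwards [hU.mem_nhds hz] with y hy
      exact (ofRealCLM.hasFDerivAt.comp y
        (differentiableAt_of_contDiffOn hU hQ hy).hasFDerivAt).fderiv
    rw [e1.fderiv_eq]
    have e2 := ((ContinuousLinearMap.compL ℝ (Cn n) ℝ ℂ ofRealCLM).hasFDerivAt.comp z
      (differentiableAt_of_contDiffOn hU h1 hz).hasFDerivAt).fderiv
    have e3 : fderiv ℝ (fun y => ofRealCLM.comp (fderiv ℝ Q y)) z = _ := e2
    rw [e3]; rfl
  have hs : fderiv ℝ (fderiv ℝ Q) z v (I • v) = fderiv ℝ (fderiv ℝ Q) z (I • v) v :=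
    ((hQ.contDiffAt (hU.mem_nhds hz)).isSymmSndFDerivAt
      (by rw [minSmoothness_of_isRCLikeNormedField]; exact ENat.LEInfty.out)).eq _ _
  have key : wirt (-I) v (wirt I v fun w => (Q w : ℂ)) z =
      ((1 / 4 * (fderiv ℝ (fderiv ℝ Q) z v v + fderiv ℝ (fderiv ℝ Q) z (I • v) (I • v)) : ℝ) : ℂ) := by
    rw [wirt, fderiv_wirt_apply hU hQc hz, fderiv_wirt_apply hU hQc hz, hdd, hdd, hdd, hdd, hs]
    push_cast
    linear_combination (-1 / 4 * fderiv ℝ (fderiv ℝ Q) z (I • v) (I • v) : ℂ) * I_sq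
  rw [key, ofReal_re]
  have := snd_fderiv_nonpos_of_isLocalMax hU hQ hz hmax v
  have := snd_fderiv_nonpos_of_isLocalMax hU hQ hz hmax (I • v)
  linarith

end Max

end HermitianMA

/-! ### Wirtinger calculus for matrix-valued functions -/

namespace HermitianMA

open Complex

variable {n : ℕ}

/-- Smoothness of a matrix-valued function on `U`. -/
def SmoothMat {m : ℕ} (A : Cn n → Matrix (Fin m) (Fin m) ℂ) (U : Set (Cn n)) : Prop :=
  ∀ i j, ContDiffOn ℝ ∞ (fun z => A z i j) U

/-- The entrywise derivative `wirt` of a matrix-valued function. -/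
noncomputable def mwirt {m : ℕ} (s : ℂ) (v : Cn n) (A : Cn n → Matrix (Fin m) (Fin m) ℂ)
    (z : Cn n) : Matrix (Fin m) (Fin m) ℂ :=
  Matrix.of fun i j => wirt s v (fun w => A w i j) z

section MatrixCalculus

variable {m : ℕ} {A B : Cn n → Matrix (Fin m) (Fin m) ℂ} {U : Set (Cn n)} {z : Cn n} {s : ℂ}
  {v : Cn n}

theorem SmoothMat.differentiableAt (hU : IsOpen U) (hA : SmoothMat A U) (hz : z ∈ U) (i j : Fin m) :
    DifferentiableAt ℝ (fun w => A w i j) z :=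
  differentiableAt_of_contDiffOn hU (hA i j) hz

theorem SmoothMat.mwirt (hU : IsOpen U) (hA : SmoothMat A U) (s : ℂ) (v : Cn n) :
    SmoothMat (mwirt s v A) U :=
  fun i j => wirt_contDiffOn hU (hA i j) s v

theorem SmoothMat.mul (hA : SmoothMat A U) (hB : SmoothMat B U) :
    SmoothMat (fun z => A z * B z) U := by
  intro i j
  simp only [Matrix.mul_apply]
  exact ContDiffOn.sum fun k _ => (hA i k).mul (hB k j)

theorem SmoothMat.add (hA : SmoothMat A U) (hB : SmoothMat B U) :
    SmoothMat (fun z => A z + B z) U := by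
  intro i j
  simp only [Matrix.add_apply]
  exact (hA i j).add (hB i j)

theorem SmoothMat.const (C : Matrix (Fin m) (Fin m) ℂ) (U : Set (Cn n)) :
    SmoothMat (fun _ : Cn n => C) U :=
  fun _ _ => contDiffOn_const

theorem SmoothMat.det (hA : SmoothMat A U) : ContDiffOn ℝ ∞ (fun z => (A z).det) U := by
  simp only [Matrix.det_apply']
  exact ContDiffOn.sum fun σ _ => contDiffOn_const.mul (contDiffOn_prod fun i _ => hA _ _)

theorem SmoothMat.trace (hA : SmoothMat A U) : ContDiffOn ℝ ∞ (fun z => (A z).trace) U := by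
  simp only [Matrix.trace]
  exact ContDiffOn.sum fun i _ => hA i i

theorem SmoothMat.adjugate (hA : SmoothMat A U) : SmoothMat (fun z => (A z).adjugate) U := by
  intro i j
  simp only [Matrix.adjugate_apply]
  refine SmoothMat.det fun a b => ?_
  by_cases h : a = j
  · subst h; simpa using contDiffOn_const
  · simpa [Matrix.updateRow_ne h] using hA a b

theorem SmoothMat.inv (hA : SmoothMat A U) (hdet : ∀ z ∈ U, (A z).det ≠ 0) :
    SmoothMat (fun z => (A z)⁻¹) U := by
  intro i j
  simp only [Matrix.inv_def, Ring.inverse_eq_inv', Matrix.smul_apply, smul_eq_mul]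
  exact (hA.det.inv hdet).mul (hA.adjugate i j)

theorem mwirt_congr (hU : IsOpen U) (hz : z ∈ U) (h : EqOn A B U) :
    mwirt s v A z = mwirt s v B z := by
  ext i j
  exact wirt_congr hU hz fun w hw => by simp only [h hw]

theorem mwirt_const (C : Matrix (Fin m) (Fin m) ℂ) : mwirt s v (fun _ => C) z = 0 := by
  ext i j
  exact wirt_const _

theorem mwirt_add (hU : IsOpen U) (hA : SmoothMat A U) (hB : SmoothMat B U) (hz : z ∈ U) :
    mwirt s v (fun w => A w + B w) z = mwirt s v A z + mwirt s v B z := by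
  ext i j
  exact wirt_add (hA.differentiableAt hU hz i j) (hB.differentiableAt hU hz i j)

theorem mwirt_mul (hU : IsOpen U) (hA : SmoothMat A U) (hB : SmoothMat B U) (hz : z ∈ U) :
    mwirt s v (fun w => A w * B w) z = mwirt s v A z * B z + A z * mwirt s v B z := by
  ext i j
  simp only [mwirt, Matrix.of_apply, Matrix.mul_apply, Matrix.add_apply]
  rw [wirt_sum _ fun k _ =>
      (hA.differentiableAt hU hz i k).fun_mul (hB.differentiableAt hU hz k j),
    ← Finset.sum_add_distrib]
  exact Finset.sum_congr rfl fun k _ =>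
    wirt_mul (hA.differentiableAt hU hz i k) (hB.differentiableAt hU hz k j)

theorem wirt_trace (hU : IsOpen U) (hA : SmoothMat A U) (hz : z ∈ U) :
    wirt s v (fun w => (A w).trace) z = (mwirt s v A z).trace :=
  wirt_sum _ fun k _ => hA.differentiableAt hU hz k k

/-- Jacobi's formula. -/
theorem wirt_det (hU : IsOpen U) (hA : SmoothMat A U) (hz : z ∈ U) :
    wirt s v (fun w => (A w).det) z = ((A z).adjugate * mwirt s v A z).trace := by
  -- By Cramer's rule a diagonal entry is the determinant of `A` with one column replaced by its
  -- derivative.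
  have h1 : ∀ i, ((A z).adjugate * mwirt s v A z) i i =
      ∑ σ : Equiv.Perm (Fin m), (σ.sign : ℂ) *
        ((∏ j ∈ Finset.univ.erase i, A z (σ j) j) * wirt s v (fun w => A w (σ i) i) z) := by
    intro i
    have e1 : ((A z).adjugate * mwirt s v A z) i i =
        ((A z).updateCol i fun k => mwirt s v A z k i).det := by
      rw [← Matrix.cramer_apply, Matrix.cramer_eq_adjugate_mulVec]
      rfl
    rw [e1, Matrix.det_apply']
    refine Finset.sum_congr rfl fun σ _ => ?_
    rw [← Finset.mul_prod_erase _ _ (Finset.mem_univ i), Matrix.updateCol_self]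
    rw [mul_comm (mwirt s v A z (σ i) i)]
    congr 2
    refine Finset.prod_congr rfl fun j hj => ?_
    rw [Matrix.updateCol_ne (Finset.ne_of_mem_erase hj)]
  have hprod : ∀ σ : Equiv.Perm (Fin m), DifferentiableAt ℝ (fun w => ∏ i, A w (σ i) i) z :=
    fun σ => differentiableAt_of_contDiffOn hU (contDiffOn_prod fun i _ => hA (σ i) i) hz
  simp only [Matrix.det_apply']
  rw [wirt_sum]
  · simp only [Matrix.trace, Matrix.diag_apply, h1]
    rw [Finset.sum_comm]
    refine Finset.sum_congr rfl fun σ _ => ?_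
    rw [wirt_const_mul, wirt_prod, Finset.mul_sum]
    · exact fun i _ => hA.differentiableAt hU hz _ _
    · exact hprod σ
  · exact fun σ _ => (differentiableAt_const _).mul (hprod σ)

/-- Expresses every `∂̄` of a Hermitian matrix through `∂`, so that quadratic expressions in first
derivatives become sums of `normSq`. -/
theorem mwirt_conjTranspose (hU : IsOpen U) (hA : SmoothMat A U) (hz : z ∈ U)
    (hH : ∀ w ∈ U, (A w).IsHermitian) (v : Cn n) (i j : Fin m) :
    mwirt I v A z i j = conj (mwirt (-I) v A z j i) := by
  simp only [mwirt, Matrix.of_apply]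
  rw [conj_wirt (hA.differentiableAt hU hz j i)]
  simp only [map_neg, conj_I, neg_neg]
  exact wirt_congr hU hz fun w hw => ((hH w hw).apply i j).symm

/-- The second derivatives of `A⁻¹ B` at a point where `A` is the identity. -/
theorem mwirt_inv_mul (hU : IsOpen U) (hA : SmoothMat A U) (hB : SmoothMat B U) (hz : z ∈ U)
    (hdet : ∀ z ∈ U, (A z).det ≠ 0) (h1 : A z = 1) (s : ℂ) (v : Cn n) :
    mwirt s v (fun w => (A w)⁻¹ * B w) z = mwirt s v B z - mwirt s v A z * B z := by
  have hE := (hA.inv hdet).mul hB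
  have e0 : EqOn (fun w => A w * ((A w)⁻¹ * B w)) B U := fun w hw => by
    simp only [← Matrix.mul_assoc]
    rw [Matrix.mul_nonsing_inv _ (isUnit_iff_ne_zero.2 (hdet w hw)), Matrix.one_mul]
  have e1 := mwirt_congr (s := s) (v := v) hU hz e0
  rw [mwirt_mul hU hA hE hz, h1] at e1
  simp only [inv_one, Matrix.one_mul] at e1
  rw [← e1]
  abel

/-- Obtained by differentiating `A (A⁻¹ B) = B` twice and solving for the highest derivative, which
is possible directly because `A z = 1`. -/
theorem mwirt_mwirt_inv_mul (hU : IsOpen U) (hA : SmoothMat A U) (hB : SmoothMat B U) (hz : z ∈ U)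
    (hdet : ∀ z ∈ U, (A z).det ≠ 0) (h1 : A z = 1) (s s' : ℂ) (v w : Cn n) :
    mwirt s v (mwirt s' w fun w => (A w)⁻¹ * B w) z =
      mwirt s v (mwirt s' w B) z - mwirt s v (mwirt s' w A) z * B z
        - mwirt s' w A z * (mwirt s v B z - mwirt s v A z * B z)
        - mwirt s v A z * (mwirt s' w B z - mwirt s' w A z * B z) := by
  have hE := (hA.inv hdet).mul hB
  have e0 : EqOn (fun w => A w * ((A w)⁻¹ * B w)) B U := fun w hw => by
    simp only [← Matrix.mul_assoc]
    rw [Matrix.mul_nonsing_inv _ (isUnit_iff_ne_zero.2 (hdet w hw)), Matrix.one_mul]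
  have e1 : EqOn (fun x => mwirt s' w A x * ((A x)⁻¹ * B x) +
      A x * mwirt s' w (fun w => (A w)⁻¹ * B w) x) (mwirt s' w B) U := fun x hx => by
    simp only
    rw [← mwirt_mul hU hA hE hx]
    exact mwirt_congr hU hx e0
  have e2 := mwirt_congr (s := s) (v := v) hU hz e1
  rw [mwirt_add hU ((hA.mwirt hU s' w).mul hE) (hA.mul (hE.mwirt hU s' w)) hz,
    mwirt_mul hU (hA.mwirt hU s' w) hE hz, mwirt_mul hU hA (hE.mwirt hU s' w) hz, h1] at e2
  rw [mwirt_inv_mul hU hA hB hz hdet h1 s v, mwirt_inv_mul hU hA hB hz hdet h1 s' w] at e2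
  simp only [inv_one, Matrix.one_mul] at e2
  rw [← e2]
  abel

theorem mwirt_inv (hU : IsOpen U) (hA : SmoothMat A U) (hz : z ∈ U)
    (hdet : ∀ z ∈ U, (A z).det ≠ 0) (s : ℂ) (v : Cn n) :
    mwirt s v (fun w => (A w)⁻¹) z = -((A z)⁻¹ * mwirt s v A z * (A z)⁻¹) := by
  have hI := hA.inv hdet
  have hu : ∀ w ∈ U, IsUnit (A w).det := fun w hw => isUnit_iff_ne_zero.2 (hdet w hw)
  have e0 : EqOn (fun w => (A w)⁻¹ * A w) (fun _ => 1) U := fun w hw =>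
    Matrix.nonsing_inv_mul _ (hu w hw)
  have e1 := mwirt_congr (s := s) (v := v) hU hz e0
  rw [mwirt_mul hU hI hA hz, mwirt_const] at e1
  have e2 := congrArg (fun X => X * (A z)⁻¹) e1
  simp only [Matrix.add_mul, Matrix.mul_assoc, Matrix.mul_nonsing_inv _ (hu z hz), Matrix.mul_one,
    Matrix.zero_mul] at e2
  rw [Matrix.mul_assoc]
  exact eq_neg_of_add_eq_zero_left e2

/-- The differentiated Monge–Ampère equation. -/
theorem wirt_logdet {F : Cn n → ℂ} (hU : IsOpen U) (hA : SmoothMat A U) (hB : SmoothMat B U)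
    (hF : ContDiffOn ℝ ∞ F U) (hAdet : ∀ z ∈ U, (A z).det ≠ 0) (hBdet : ∀ z ∈ U, (B z).det ≠ 0)
    (h : ∀ z ∈ U, (B z).det = exp (F z) * (A z).det) (hz : z ∈ U) (s : ℂ) (v : Cn n) :
    ((B z)⁻¹ * mwirt s v B z).trace = wirt s v F z + ((A z)⁻¹ * mwirt s v A z).trace := by
  have hFd := differentiableAt_of_contDiffOn hU hF hz
  have adj : ∀ C : Matrix (Fin m) (Fin m) ℂ, C.det ≠ 0 → C.adjugate = C.det • C⁻¹ := by
    intro C hC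
    rw [Matrix.inv_def, Ring.inverse_eq_inv', smul_smul, mul_inv_cancel₀ hC, one_smul]
  have e1 := wirt_congr (s := s) (v := v) hU hz (f := fun z => (B z).det)
    (g := fun z => exp (F z) * (A z).det) h
  rw [wirt_det hU hB hz, wirt_mul hFd.cexp (differentiableAt_of_contDiffOn hU hA.det hz),
    wirt_exp hFd, wirt_det hU hA hz, adj _ (hBdet z hz), adj _ (hAdet z hz), Matrix.smul_mul,
    Matrix.smul_mul, Matrix.trace_smul, Matrix.trace_smul, smul_eq_mul, smul_eq_mul] at e1
  refine mul_left_cancel₀ (hBdet z hz) ?_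
  rw [e1, h z hz]
  ring

/-- One more derivative of `wirt_logdet`. The derivative of the inverse produces the quadratic term
on each side; the one in `B` is the good third order square of the estimate. -/
theorem wirt_wirt_logdet {F : Cn n → ℂ} (hU : IsOpen U) (hA : SmoothMat A U) (hB : SmoothMat B U)
    (hF : ContDiffOn ℝ ∞ F U) (hAdet : ∀ z ∈ U, (A z).det ≠ 0) (hBdet : ∀ z ∈ U, (B z).det ≠ 0)
    (h : ∀ z ∈ U, (B z).det = exp (F z) * (A z).det) (hz : z ∈ U) (s s' : ℂ) (v w : Cn n) :
    ((B z)⁻¹ * mwirt s v (mwirt s' w B) z).trace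
        - ((B z)⁻¹ * mwirt s v B z * ((B z)⁻¹ * mwirt s' w B z)).trace =
      wirt s v (wirt s' w F) z + ((A z)⁻¹ * mwirt s v (mwirt s' w A) z).trace
        - ((A z)⁻¹ * mwirt s v A z * ((A z)⁻¹ * mwirt s' w A z)).trace := by
  have hAi := hA.inv hAdet
  have hBi := hB.inv hBdet
  have e1 := wirt_congr (s := s) (v := v) hU hz (f := fun z => ((B z)⁻¹ * mwirt s' w B z).trace)
    (g := fun z => wirt s' w F z + ((A z)⁻¹ * mwirt s' w A z).trace)
    fun x hx => wirt_logdet hU hA hB hF hAdet hBdet h hx s' w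
  have hAm := hAi.mul (hA.mwirt hU s' w)
  have hBm := hBi.mul (hB.mwirt hU s' w)
  rw [wirt_add (differentiableAt_of_contDiffOn hU (wirt_contDiffOn hU hF s' w) hz)
    (differentiableAt_of_contDiffOn hU hAm.trace hz), wirt_trace hU hBm hz, wirt_trace hU hAm hz,
    mwirt_mul hU hBi (hB.mwirt hU s' w) hz, mwirt_mul hU hAi (hA.mwirt hU s' w) hz,
    mwirt_inv hU hA hz hAdet, mwirt_inv hU hB hz hBdet] at e1
  simp only [Matrix.trace_add, Matrix.neg_mul, Matrix.trace_neg, Matrix.mul_assoc] at e1 ⊢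
  linear_combination e1

end MatrixCalculus

end HermitianMA

/-! ### The local estimate at a maximum point in an adapted frame -/

namespace HermitianMA

open Complex

variable {n : ℕ}

section LocalEstimate

variable {U : Set (Cn n)} {p : Cn n}

/-- Symmetry of the fourth derivatives of `φ`, the source of hypothesis `hs` of
`trace_jet_inequality`. -/
theorem wirt_four_comm {f : Cn n → ℂ} (hU : IsOpen U) (hf : ContDiffOn ℝ ∞ f U) {z : Cn n}
    (hz : z ∈ U) (v w : Cn n) :
    wirt (-I) v (wirt I v (wirt (-I) w (wirt I w f))) z =
      wirt (-I) w (wirt I w (wirt (-I) v (wirt I v f))) z := by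
  have hd := fun s v => wirt_contDiffOn hU hf s v
  have hdd := fun s v s' v' => wirt_contDiffOn hU (hd s v) s' v'
  calc _ = wirt (-I) v (wirt (-I) w (wirt I v (wirt I w f))) z :=
        wirt_congr hU hz fun x hx => wirt_comm hU (hd I w) hx I (-I) v w
    _ = wirt (-I) w (wirt (-I) v (wirt I v (wirt I w f))) z := wirt_comm hU (hdd I w I v) hz _ _ _ _
    _ = wirt (-I) w (wirt (-I) v (wirt I w (wirt I v f))) z :=
        wirt_congr hU hz fun x hx => wirt_congr hU hx fun y hy => wirt_comm hU hf hy I I v w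
    _ = _ := wirt_congr hU hz fun x hx => wirt_comm hU (hd I v) hx (-I) I v w

theorem wirt_I_ofReal {f : Cn n → ℝ} {z : Cn n} (hf : DifferentiableAt ℝ f z) (v : Cn n) :
    wirt I v (fun w => (f w : ℂ)) z = conj (wirt (-I) v (fun w => (f w : ℂ)) z) := by
  have hd : DifferentiableAt ℝ (fun w => (f w : ℂ)) z := ofRealCLM.differentiableAt.comp z hf
  rw [conj_wirt hd]
  simp

/-- Derivatives of the logarithm of a positive function. -/
theorem wirt_log {u : Cn n → ℝ} (hU : IsOpen U) (hu : ContDiffOn ℝ ∞ u U) (hu0 : ∀ z ∈ U, 0 < u z)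
    (hp : p ∈ U) (v : Cn n) :
    wirt (-I) v (fun w => (Real.log (u w) : ℂ)) p = wirt (-I) v (fun w => (u w : ℂ)) p / u p ∧
    (wirt (-I) v (wirt I v fun w => (Real.log (u w) : ℂ)) p).re =
      (wirt (-I) v (wirt I v fun w => (u w : ℂ)) p).re / u p -
        normSq (wirt (-I) v (fun w => (u w : ℂ)) p) / u p ^ 2 := by
  have hL : ContDiffOn ℝ ∞ (fun w => Real.log (u w)) U := hu.log fun z hz => (hu0 z hz).ne'
  have hLc : ContDiffOn ℝ ∞ (fun w => (Real.log (u w) : ℂ)) U := ofRealCLM.contDiff.comp_contDiffOn hL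
  -- Differentiating `u = exp (log u)` requires only the product rule and the rule for `exp`.
  have hexp : EqOn (fun w => (u w : ℂ)) (fun w => exp (Real.log (u w) : ℂ)) U := fun z hz => by
    simp only
    rw [← ofReal_exp, Real.exp_log (hu0 z hz)]
  have e1 : ∀ s, ∀ z ∈ U, wirt s v (fun w => (u w : ℂ)) z =
      exp (Real.log (u z) : ℂ) * wirt s v (fun w => (Real.log (u w) : ℂ)) z := by
    intro s z hz
    rw [wirt_congr hU hz hexp, wirt_exp (differentiableAt_of_contDiffOn hU hLc hz)]
  have hpos := hu0 p hp
  have hne : (u p : ℂ) ≠ 0 := ofReal_ne_zero.2 hpos.ne'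
  have hup : exp (Real.log (u p) : ℂ) = u p := (hexp hp).symm
  have e2 : wirt (-I) v (fun w => (Real.log (u w) : ℂ)) p = wirt (-I) v (fun w => (u w : ℂ)) p / u p := by
    rw [eq_div_iff hne, e1 _ p hp, hup]; ring
  refine ⟨e2, ?_⟩
  have e3 := wirt_congr (s := -I) (v := v) hU hp (e1 I)
  rw [wirt_mul (differentiableAt_of_contDiffOn hU hLc hp).cexp
    (differentiableAt_of_contDiffOn hU (wirt_contDiffOn hU hLc I v) hp),
    wirt_exp (differentiableAt_of_contDiffOn hU hLc hp), hup,
    wirt_I_ofReal (differentiableAt_of_contDiffOn hU hL hp), mul_assoc, mul_conj, e2] at e3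
  rw [e3]
  have e4 : normSq (wirt (-I) v (fun w => (u w : ℂ)) p / u p) =
      normSq (wirt (-I) v (fun w => (u w : ℂ)) p) / u p ^ 2 := by
    rw [normSq_div, normSq_ofReal, sq]
  rw [e4, add_re, re_ofReal_mul, re_ofReal_mul, ofReal_re]
  have := hpos.ne'
  field_simp
  ring

/-- Derivatives of the reciprocal of a positive function. -/
theorem wirt_recip {f : Cn n → ℝ} (hU : IsOpen U) (hf : ContDiffOn ℝ ∞ f U) (hf0 : ∀ z ∈ U, 0 < f z)
    (hp : p ∈ U) (v : Cn n) :
    wirt (-I) v (fun w => (((f w)⁻¹ : ℝ) : ℂ)) p =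
      -(((f p)⁻¹ ^ 2 : ℝ) : ℂ) * wirt (-I) v (fun w => (f w : ℂ)) p ∧
    (wirt (-I) v (wirt I v fun w => (((f w)⁻¹ : ℝ) : ℂ)) p).re =
      2 * (f p)⁻¹ ^ 3 * normSq (wirt (-I) v (fun w => (f w : ℂ)) p) -
        (f p)⁻¹ ^ 2 * (wirt (-I) v (wirt I v fun w => (f w : ℂ)) p).re := by
  have hr : ContDiffOn ℝ ∞ (fun w => (f w)⁻¹) U := hf.inv fun z hz => (hf0 z hz).ne'
  have hfc : ContDiffOn ℝ ∞ (fun w => (f w : ℂ)) U := ofRealCLM.contDiff.comp_contDiffOn hf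
  have hrc : ContDiffOn ℝ ∞ (fun w => (((f w)⁻¹ : ℝ) : ℂ)) U := ofRealCLM.contDiff.comp_contDiffOn hr
  have hd := fun z (hz : z ∈ U) => differentiableAt_of_contDiffOn hU hfc hz
  have hdr := fun z (hz : z ∈ U) => differentiableAt_of_contDiffOn hU hrc hz
  -- Both formulas follow by differentiating `f⁻¹ f = 1` once and twice.
  have hone : EqOn (fun w => (((f w)⁻¹ : ℝ) : ℂ) * (f w : ℂ)) (fun _ => 1) U := fun z hz => by
    simp only
    rw [← ofReal_mul, inv_mul_cancel₀ (hf0 z hz).ne', ofReal_one]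
  have e1 : ∀ s, ∀ z ∈ U, wirt s v (fun w => (((f w)⁻¹ : ℝ) : ℂ)) z * (f z : ℂ) +
      (((f z)⁻¹ : ℝ) : ℂ) * wirt s v (fun w => (f w : ℂ)) z = 0 := by
    intro s z hz
    rw [← wirt_mul (hdr z hz) (hd z hz), wirt_congr hU hz hone, wirt_const]
  have hpos := hf0 p hp
  have hne : (f p : ℂ) ≠ 0 := ofReal_ne_zero.2 hpos.ne'
  have e2 : wirt (-I) v (fun w => (((f w)⁻¹ : ℝ) : ℂ)) p =
      -(((f p)⁻¹ ^ 2 : ℝ) : ℂ) * wirt (-I) v (fun w => (f w : ℂ)) p := by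
    refine mul_right_cancel₀ hne ?_
    rw [eq_neg_of_add_eq_zero_left (e1 (-I) p hp)]
    push_cast
    field_simp
  refine ⟨e2, ?_⟩
  have dd := differentiableAt_of_contDiffOn hU (wirt_contDiffOn hU hfc I v) hp
  have ddr := differentiableAt_of_contDiffOn hU (wirt_contDiffOn hU hrc I v) hp
  have e3 := wirt_congr (s := -I) (v := v) hU hp (g := fun _ => (0 : ℂ)) (e1 I)
  rw [wirt_const, wirt_add (ddr.fun_mul (hd p hp)) ((hdr p hp).fun_mul dd), wirt_mul ddr (hd p hp),
    wirt_mul (hdr p hp) dd, wirt_I_ofReal (differentiableAt_of_contDiffOn hU hf hp),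
    wirt_I_ofReal (differentiableAt_of_contDiffOn hU hr hp), e2] at e3
  set X := wirt (-I) v (fun w => (f w : ℂ)) p with hX
  have e4 : wirt (-I) v (wirt I v fun w => (((f w)⁻¹ : ℝ) : ℂ)) p =
      ((2 * (f p)⁻¹ ^ 3 * normSq X : ℝ) : ℂ) -
        (((f p)⁻¹ ^ 2 : ℝ) : ℂ) * wirt (-I) v (wirt I v fun w => (f w : ℂ)) p := by
    refine mul_right_cancel₀ hne ?_
    simp only [map_mul, map_neg, conj_ofReal] at e3
    push_cast at e3 ⊢
    rw [← mul_conj X]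
    field_simp
    field_simp at e3
    linear_combination e3
  rw [e4, sub_re, ofReal_re, re_ofReal_mul]

theorem trace_diagonal_mul {d : Fin n → ℂ} {X : Matrix (Fin n) (Fin n) ℂ} :
    (Matrix.diagonal d * X).trace = ∑ i, d i * X i i := by
  simp [Matrix.trace, Matrix.diagonal_mul]

/-- The maximum principle for `log u - A φ + 1 / (φ - m + 1)`, `u = tr_g g'`, in a frame `ℓ` that is
orthonormal for `g` and orthogonal for `g'` at the maximum point. -/
theorem trace_le_of_isLocalMax_frame (hn : 0 < n) (hU : IsOpen U) (hp : p ∈ U)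
    {G H : Cn n → Matrix (Fin n) (Fin n) ℂ} (hG : SmoothMat G U) (hH : SmoothMat H U)
    (hGh : ∀ z ∈ U, (G z).IsHermitian) (hHh : ∀ z ∈ U, (H z).IsHermitian)
    (hGd : ∀ z ∈ U, (G z).det ≠ 0) (hHd : ∀ z ∈ U, (H z).det ≠ 0)
    {φ F : Cn n → ℝ} (hφ : ContDiffOn ℝ ∞ φ U) (hF : ContDiffOn ℝ ∞ F U) {l : Fin n → Cn n}
    (hHφ : ∀ z ∈ U, ∀ j k, H z j k = G z j k +
      wirt (-I) (l j) (wirt I (l k) fun w => (φ w : ℂ)) z)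
    (hMA : ∀ z ∈ U, (H z).det = exp (F z) * (G z).det)
    (hG1 : G p = 1) {lam : Fin n → ℝ} (hlam : ∀ i, 0 < lam i)
    (hHp : H p = Matrix.diagonal fun i => (lam i : ℂ))
    {u : Cn n → ℝ} (hu : ∀ z ∈ U, (u z : ℂ) = ((G z)⁻¹ * H z).trace) (hu0 : ∀ z ∈ U, 0 < u z)
    {B K : ℝ} (hB : 0 ≤ B)
    (hg1 : ∀ i j k, ‖wirt (-I) (l i) (fun w => G w j k) p‖ ≤ B)
    (hg2 : ∀ i k, ‖wirt (-I) (l i) (wirt I (l i) fun w => G w k k) p‖ ≤ B)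
    (hFK : |F p| ≤ K)
    (hΔF : -K ≤ ∑ k, (wirt (-I) (l k) (wirt I (l k) fun w => (F w : ℂ)) p).re)
    {m A : ℝ} (hm : ∀ z ∈ U, m ≤ φ z) (hA : A = laplacianConst n B K + 2)
    (hmax : IsLocalMax (fun z => Real.log (u z) - A * φ z + (φ z - m + 1)⁻¹) p) :
    (φ p - m + 1)⁻¹ ^ 3 * u p ^ 2 ≤ ((A + 1) * (2 * n * B)) ^ 2 ∨
      u p ≤ n * (Real.exp K * (1 + (A + 1) * n) ^ n) := by
  have hK : 0 ≤ K := (abs_nonneg _).trans hFK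
  have hφc : ContDiffOn ℝ ∞ (fun w => (φ w : ℂ)) U := ofRealCLM.contDiff.comp_contDiffOn hφ
  have hFc : ContDiffOn ℝ ∞ (fun w => (F w : ℂ)) U := ofRealCLM.contDiff.comp_contDiffOn hF
  have hE : SmoothMat (fun z => (G z)⁻¹ * H z) U := (hG.inv hGd).mul hH
  have huc : ContDiffOn ℝ ∞ (fun w => (u w : ℂ)) U := hE.trace.congr hu
  have hur : ContDiffOn ℝ ∞ u U := reCLM.contDiff.comp_contDiffOn huc
  have hup : u p = ∑ k, lam k := by
    have h := hu p hp
    rw [hG1, hHp, inv_one, Matrix.one_mul, Matrix.trace_diagonal] at h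
    exact_mod_cast h
  have hs0 : ∀ z ∈ U, 0 < φ z - m + 1 := fun z hz => by linarith [hm z hz]
  have hsd : ContDiffOn ℝ ∞ (fun z => φ z - m + 1) U :=
    (hφ.sub contDiffOn_const).add contDiffOn_const
  have hHinv : (H p)⁻¹ = Matrix.diagonal fun i => ((lam i : ℂ))⁻¹ := by
    refine Matrix.inv_eq_left_inv ?_
    rw [hHp, Matrix.diagonal_mul_diagonal, ← Matrix.diagonal_one]
    congr 1
    ext i
    exact inv_mul_cancel₀ (ofReal_ne_zero.2 (hlam i).ne')
  -- the entries of `H` in terms of `φ`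
  have hH1 : ∀ s v, ∀ z ∈ U, ∀ j k, wirt s v (fun w => H w j k) z = wirt s v (fun w => G w j k) z +
      wirt s v (wirt (-I) (l j) (wirt I (l k) fun w => (φ w : ℂ))) z := by
    intro s v z hz j k
    rw [← wirt_add (hG.differentiableAt hU hz j k) (differentiableAt_of_contDiffOn hU
      (wirt_contDiffOn hU (wirt_contDiffOn hU hφc _ _) _ _) hz)]
    exact wirt_congr hU hz fun w hw => hHφ w hw j k
  have hH2 : ∀ i k, wirt (-I) (l i) (wirt I (l i) fun w => H w k k) p =
      wirt (-I) (l i) (wirt I (l i) fun w => G w k k) p + wirt (-I) (l i) (wirt I (l i)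
        (wirt (-I) (l k) (wirt I (l k) fun w => (φ w : ℂ)))) p := by
    intro i k
    rw [← wirt_add (differentiableAt_of_contDiffOn hU (wirt_contDiffOn hU (hG k k) _ _) hp)
      (differentiableAt_of_contDiffOn hU (wirt_contDiffOn hU (wirt_contDiffOn hU
        (wirt_contDiffOn hU hφc _ _) _ _) _ _) hp)]
    exact wirt_congr hU hp fun w hw => hH1 _ _ w hw k k
  -- `H - G` is a complex Hessian, so its antisymmetrized derivative vanishes and the torsions
  -- agree.
  have ht : ∀ i j k, wirt (-I) (l i) (fun w => H w j k) p - wirt (-I) (l j) (fun w => H w i k) p =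
      wirt (-I) (l i) (fun w => G w j k) p - wirt (-I) (l j) (fun w => G w i k) p := by
    intro i j k
    rw [hH1 _ _ p hp, hH1 _ _ p hp, wirt_comm hU (wirt_contDiffOn hU hφc I (l k)) hp _ _ (l i) (l j)]
    ring
  have hs : ∀ i k, (wirt (-I) (l i) (wirt I (l i) fun w => H w k k) p).re -
      (wirt (-I) (l k) (wirt I (l k) fun w => H w i i) p).re =
      (wirt (-I) (l i) (wirt I (l i) fun w => G w k k) p).re -
      (wirt (-I) (l k) (wirt I (l k) fun w => G w i i) p).re := by
    intro i k
    rw [hH2, hH2, wirt_four_comm hU hφc hp (l i) (l k)]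
    simp only [add_re]
    ring
  have hφ2 : ∀ i, (wirt (-I) (l i) (wirt I (l i) fun w => (φ w : ℂ)) p).re = lam i - 1 := by
    intro i
    have h := hHφ p hp i i
    rw [hHp, hG1, Matrix.diagonal_apply_eq, Matrix.one_apply_eq] at h
    have h' := congrArg re h
    rw [ofReal_re, add_re, one_re] at h'
    linarith
  -- derivatives of the trace
  have hu1 : ∀ i, wirt (-I) (l i) (fun w => (u w : ℂ)) p = ∑ k,
      (wirt (-I) (l i) (fun w => H w k k) p - wirt (-I) (l i) (fun w => G w k k) p * lam k) := by
    intro i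
    rw [wirt_congr hU hp (g := fun z => ((G z)⁻¹ * H z).trace) hu, wirt_trace hU hE hp,
      mwirt_inv_mul hU hG hH hp hGd hG1, hHp]
    simp [Matrix.trace, mwirt, Matrix.mul_diagonal]
  have hu2 : ∀ i, (wirt (-I) (l i) (wirt I (l i) fun w => (u w : ℂ)) p).re =
      ∑ k, (wirt (-I) (l i) (wirt I (l i) fun w => H w k k) p).re -
      ∑ j, ∑ k, 2 * (conj (wirt (-I) (l i) (fun w => G w j k) p) *
        wirt (-I) (l i) (fun w => H w j k) p).re +
      ∑ j, lam j * (∑ k, normSq (wirt (-I) (l i) (fun w => G w j k) p) +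
        ∑ k, normSq (wirt (-I) (l i) (fun w => G w k j) p) -
        (wirt (-I) (l i) (wirt I (l i) fun w => G w j j) p).re) := by
    intro i
    have e1 : wirt (-I) (l i) (wirt I (l i) fun w => (u w : ℂ)) p =
        (mwirt (-I) (l i) (mwirt I (l i) fun z => (G z)⁻¹ * H z) p).trace := by
      rw [← wirt_trace hU (hE.mwirt hU _ _) hp]
      refine wirt_congr hU hp fun z hz => ?_
      rw [wirt_congr hU hz (g := fun z => ((G z)⁻¹ * H z).trace) hu, wirt_trace hU hE hz]
    set a := mwirt (-I) (l i) G p with ha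
    set b := mwirt (-I) (l i) H p with hb
    have ha' : ∀ j k, mwirt I (l i) G p j k = conj (a k j) := fun j k =>
      mwirt_conjTranspose hU hG hp hGh _ _ _
    have hb' : ∀ j k, mwirt I (l i) H p j k = conj (b k j) := fun j k =>
      mwirt_conjTranspose hU hH hp hHh _ _ _
    rw [e1, mwirt_mwirt_inv_mul hU hG hH hp hGd hG1]
    simp only [Matrix.trace_sub, Matrix.mul_sub, ← Matrix.mul_assoc]
    rw [hHp]
    have t1 : (mwirt (-I) (l i) (mwirt I (l i) H) p).trace.re =
        ∑ k, (wirt (-I) (l i) (wirt I (l i) fun w => H w k k) p).re := by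
      simp only [Matrix.trace, re_sum]; rfl
    have t2 : (mwirt (-I) (l i) (mwirt I (l i) G) p * Matrix.diagonal fun i => (lam i : ℂ)).trace.re =
        ∑ k, lam k * (wirt (-I) (l i) (wirt I (l i) fun w => G w k k) p).re := by
      simp only [Matrix.trace, re_sum, Matrix.diag_apply, Matrix.mul_diagonal, re_mul_ofReal]
      exact Finset.sum_congr rfl fun k _ => mul_comm _ _
    -- The cross terms `t3` and `t4` are complex conjugates of each other, whence the factor `2` in
    -- front of the real part.
    have t3 : (mwirt I (l i) G p * b).trace = ∑ j, ∑ k, conj (a j k) * b j k := by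
      rw [Finset.sum_comm]
      simp only [Matrix.trace, Matrix.diag_apply, Matrix.mul_apply, ha']
    have t4 : (a * mwirt I (l i) H p).trace = ∑ j, ∑ k, conj (conj (a j k) * b j k) := by
      simp only [Matrix.trace, Matrix.diag_apply, Matrix.mul_apply, hb', map_mul, conj_conj]
    have t5 : (mwirt I (l i) G p * a * Matrix.diagonal fun i => (lam i : ℂ)).trace =
        ((∑ j, lam j * ∑ k, normSq (a k j) : ℝ) : ℂ) := by
      simp only [Matrix.trace, Matrix.diag_apply, Matrix.mul_diagonal]
      simp only [Matrix.mul_apply, ha']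
      push_cast
      refine Finset.sum_congr rfl fun j _ => ?_
      rw [mul_comm]
      congr 1
      exact Finset.sum_congr rfl fun k _ => by rw [mul_comm, mul_conj]
    have t6 : (a * mwirt I (l i) G p * Matrix.diagonal fun i => (lam i : ℂ)).trace =
        ((∑ j, lam j * ∑ k, normSq (a j k) : ℝ) : ℂ) := by
      simp only [Matrix.trace, Matrix.diag_apply, Matrix.mul_diagonal]
      simp only [Matrix.mul_apply, ha']
      push_cast
      refine Finset.sum_congr rfl fun j _ => ?_
      rw [mul_comm]
      congr 1
      exact Finset.sum_congr rfl fun k _ => by rw [mul_conj]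
    simp only [sub_re, t1, t2]
    rw [t3, t4, t5, t6]
    simp only [re_sum, conj_re, ofReal_re]
    have hae : ∀ j k, wirt (-I) (l i) (fun w => G w j k) p = a j k := fun _ _ => rfl
    have hbe : ∀ j k, wirt (-I) (l i) (fun w => H w j k) p = b j k := fun _ _ => rfl
    simp only [hae, hbe, mul_add, mul_sub, Finset.sum_add_distrib, Finset.sum_sub_distrib,
      ← Finset.mul_sum]
    ring
  -- the differentiated Monge–Ampère equation
  have hMA2 : ∀ k, ∑ i, (wirt (-I) (l k) (wirt I (l k) fun w => H w i i) p).re / lam i -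
      ∑ i, ∑ j, normSq (wirt (-I) (l k) (fun w => H w i j) p) / (lam i * lam j) =
      (wirt (-I) (l k) (wirt I (l k) fun w => (F w : ℂ)) p).re +
      ∑ i, (wirt (-I) (l k) (wirt I (l k) fun w => G w i i) p).re -
      ∑ i, ∑ j, normSq (wirt (-I) (l k) (fun w => G w i j) p) := by
    intro k
    have h := wirt_wirt_logdet hU hG hH hFc hGd hHd hMA hp (-I) I (l k) (l k)
    set a := mwirt (-I) (l k) G p with ha
    set b := mwirt (-I) (l k) H p with hb
    have ha' : ∀ i j, mwirt I (l k) G p i j = conj (a j i) := fun i j =>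
      mwirt_conjTranspose hU hG hp hGh _ _ _
    have hb' : ∀ i j, mwirt I (l k) H p i j = conj (b j i) := fun i j =>
      mwirt_conjTranspose hU hH hp hHh _ _ _
    have q1 : ((H p)⁻¹ * mwirt (-I) (l k) (mwirt I (l k) H) p).trace.re =
        ∑ i, (wirt (-I) (l k) (wirt I (l k) fun w => H w i i) p).re / lam i := by
      rw [hHinv, trace_diagonal_mul, re_sum]
      refine Finset.sum_congr rfl fun i _ => ?_
      rw [← ofReal_inv, re_ofReal_mul, div_eq_inv_mul]
      rfl
    have q2 : ((H p)⁻¹ * b * ((H p)⁻¹ * mwirt I (l k) H p)).trace.re =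
        ∑ i, ∑ j, normSq (b i j) / (lam i * lam j) := by
      rw [hHinv]
      simp only [Matrix.trace, Matrix.diag_apply, Matrix.mul_apply (N := _ * _),
        Matrix.diagonal_mul, hb', re_sum]
      refine Finset.sum_congr rfl fun i _ => Finset.sum_congr rfl fun j _ => ?_
      have : (lam i : ℂ)⁻¹ * b i j * ((lam j : ℂ)⁻¹ * conj (b i j)) =
          ((normSq (b i j) / (lam i * lam j) : ℝ) : ℂ) := by
        push_cast
        rw [← mul_conj (b i j)]
        have h1 : (lam i : ℂ) ≠ 0 := ofReal_ne_zero.2 (hlam i).ne'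
        have h2 : (lam j : ℂ) ≠ 0 := ofReal_ne_zero.2 (hlam j).ne'
        field_simp
      rw [this, ofReal_re]
    have q3 : ((G p)⁻¹ * mwirt (-I) (l k) (mwirt I (l k) G) p).trace.re =
        ∑ i, (wirt (-I) (l k) (wirt I (l k) fun w => G w i i) p).re := by
      rw [hG1, inv_one, Matrix.one_mul]
      simp only [Matrix.trace, re_sum]; rfl
    have q4 : ((G p)⁻¹ * a * ((G p)⁻¹ * mwirt I (l k) G p)).trace.re = ∑ i, ∑ j, normSq (a i j) := by
      rw [hG1, inv_one, Matrix.one_mul, Matrix.one_mul]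
      simp only [Matrix.trace, Matrix.diag_apply, Matrix.mul_apply, ha', re_sum, mul_conj, ofReal_re]
    have h' := congrArg re h
    simp only [sub_re, add_re] at h'
    rw [q1, q2, q3, q4] at h'
    exact h'
  have hprod : ∏ i, lam i = Real.exp (F p) := by
    have h := hMA p hp
    rw [hHp, hG1, Matrix.det_diagonal, Matrix.det_one, mul_one] at h
    exact_mod_cast h
  -- the conditions at the maximum
  have hLog := fun i => wirt_log hU hur hu0 hp (l i)
  have hRec := fun i => wirt_recip hU hsd hs0 hp (l i)
  have hLs : ContDiffOn ℝ ∞ (fun w => Real.log (u w)) U := hur.log fun z hz => (hu0 z hz).ne'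
  have hrs : ContDiffOn ℝ ∞ (fun w => (φ w - m + 1)⁻¹) U := hsd.inv fun z hz => (hs0 z hz).ne'
  have hLc : ContDiffOn ℝ ∞ (fun w => (Real.log (u w) : ℂ)) U :=
    ofRealCLM.contDiff.comp_contDiffOn hLs
  have hrc : ContDiffOn ℝ ∞ (fun w => (((φ w - m + 1)⁻¹ : ℝ) : ℂ)) U :=
    ofRealCLM.contDiff.comp_contDiffOn hrs
  have hQ : ContDiffOn ℝ ∞ (fun z => Real.log (u z) - A * φ z + (φ z - m + 1)⁻¹) U :=
    (hLs.sub (contDiffOn_const.mul hφ)).add hrs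
  have hQ1 : ∀ s v, ∀ z ∈ U,
      wirt s v (fun z => ((Real.log (u z) - A * φ z + (φ z - m + 1)⁻¹ : ℝ) : ℂ)) z =
      wirt s v (fun w => (Real.log (u w) : ℂ)) z - A * wirt s v (fun w => (φ w : ℂ)) z +
        wirt s v (fun w => (((φ w - m + 1)⁻¹ : ℝ) : ℂ)) z := by
    intro s v z hz
    have d1 := differentiableAt_of_contDiffOn hU hLc hz
    have d2 := differentiableAt_of_contDiffOn hU hφc hz
    have d3 := differentiableAt_of_contDiffOn hU hrc hz
    rw [← wirt_const_mul _ d2, ← wirt_sub d1 (d2.const_mul _),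
      ← wirt_add (d1.fun_sub (d2.const_mul _)) d3]
    refine wirt_congr hU hz fun w _ => ?_
    simp only [ofReal_add, ofReal_sub, ofReal_mul]
  have hs1 : ∀ s v, ∀ z ∈ U, wirt s v (fun w => ((φ w - m + 1 : ℝ) : ℂ)) z =
      wirt s v (fun w => (φ w : ℂ)) z := by
    intro s v z hz
    have d2 := differentiableAt_of_contDiffOn hU hφc hz
    have e := wirt_add (s := s) (v := v) d2 (differentiableAt_const (-(m : ℂ) + 1))
    rw [wirt_const, add_zero] at e
    rw [← e]
    refine wirt_congr hU hz fun w _ => ?_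
    push_cast; ring
  have hs2 : ∀ v, wirt (-I) v (wirt I v fun w => ((φ w - m + 1 : ℝ) : ℂ)) p =
      wirt (-I) v (wirt I v fun w => (φ w : ℂ)) p :=
    fun v => wirt_congr hU hp fun z hz => hs1 I v z hz
  set r := (φ p - m + 1)⁻¹ with hr
  have hr0 : 0 < r := inv_pos.2 (hs0 p hp)
  have hr1 : r ≤ 1 := inv_le_one_of_one_le₀ (by linarith [hm p hp])
  -- With `s = φ - m + 1` and `r = 1/s` one has `∂r = -r² ∂φ` and `∂∂̄r = 2 r³ |∂φ|² - r² ∂∂̄φ`.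
  -- Vanishing of the first derivative and nonpositivity of the second at the maximum become `hcrit`
  -- and `hmax`.
  have key := trace_le_of_jet hn hlam (u1 := fun i => wirt (-I) (l i) (fun w => (u w : ℂ)) p)
    hB hK ht hs hu1 hu2 hMA2 hΔF hg1 (fun i k => (abs_re_le_norm _).trans (hg2 i k))
    (by rw [hprod]; exact Real.exp_le_exp.2 (abs_le.1 hFK).2)
    (by rw [hprod]; exact Real.exp_le_exp.2 (abs_le.1 hFK).1) hA hr0 hr1
    (p1 := fun i => wirt (-I) (l i) (fun w => (φ w : ℂ)) p)
    (fun i => by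
      have h0 := wirt_eq_zero_of_isLocalMax (differentiableAt_of_contDiffOn hU hQ hp) hmax (-I) (l i)
      rw [hQ1 _ _ p hp, (hLog i).1, (hRec i).1, hs1 _ _ p hp, hup] at h0
      push_cast at h0 ⊢
      linear_combination h0)
    (fun i => by
      have h0 := wirt_wirt_nonpos_of_isLocalMax hU hQ hp hmax (l i)
      have d := fun {f : Cn n → ℂ} (hf : ContDiffOn ℝ ∞ f U) =>
        differentiableAt_of_contDiffOn hU (wirt_contDiffOn hU hf I (l i)) hp
      rw [wirt_congr hU hp (hQ1 I (l i)), wirt_add ((d hLc).fun_sub ((d hφc).const_mul _)) (d hrc),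
        wirt_sub (d hLc) ((d hφc).const_mul _), wirt_const_mul _ (d hφc), add_re, sub_re,
        re_ofReal_mul, (hLog i).2, (hRec i).2, hs2, hs1 _ _ p hp, hφ2, hup] at h0
      exact h0)
  rw [hup]
  exact key

end LocalEstimate

end HermitianMA

/-! ### Simultaneous diagonalization and passage to a constant frame -/

namespace HermitianMA

open Complex

variable {n : ℕ}

theorem exists_unitary_diagonalization {A : Matrix (Fin n) (Fin n) ℂ} (hA : A.PosDef) :
    ∃ (V : Matrix (Fin n) (Fin n) ℂ) (lam : Fin n → ℝ), (∀ i, 0 < lam i) ∧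
      Vᴴ * V = 1 ∧ Vᴴ * A * V = Matrix.diagonal fun i => (lam i : ℂ) := by
  refine ⟨hA.isHermitian.eigenvectorUnitary, hA.isHermitian.eigenvalues, hA.eigenvalues_pos,
    Matrix.mem_unitaryGroup_iff'.1 hA.isHermitian.eigenvectorUnitary.2, ?_⟩
  have h := hA.isHermitian.conjStarAlgAut_star_eigenvectorUnitary
  rw [Unitary.conjStarAlgAut_apply] at h
  simp only [star_star, Unitary.coe_star] at h
  exact h

theorem det_ne_zero_of_congruence_eq_one {G P : Matrix (Fin n) (Fin n) ℂ} (h : Pᴴ * G * P = 1) :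
    P.det ≠ 0 := by
  intro h0
  have := congrArg Matrix.det h
  rw [Matrix.det_mul, h0, mul_zero, Matrix.det_one] at this
  exact zero_ne_one this

/-- Simultaneous diagonalization of two positive definite Hermitian matrices. -/
theorem exists_simultaneous_diagonalization {G H : Matrix (Fin n) (Fin n) ℂ} (hG : G.PosDef)
    (hH : H.PosDef) : ∃ (P : Matrix (Fin n) (Fin n) ℂ) (lam : Fin n → ℝ), (∀ i, 0 < lam i) ∧
      Pᴴ * G * P = 1 ∧ Pᴴ * H * P = Matrix.diagonal fun i => (lam i : ℂ) := by
  obtain ⟨V, μ, hμ, -, hV⟩ := exists_unitary_diagonalization hG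
  -- `V D` makes `G` the identity; a further unitary change then diagonalizes `H` without disturbing
  -- this.
  set D : Matrix (Fin n) (Fin n) ℂ := Matrix.diagonal fun i => (((√(μ i))⁻¹ : ℝ) : ℂ) with hD
  have hDh : Dᴴ = D := by
    rw [hD, Matrix.diagonal_conjTranspose]
    congr 1
    ext i
    exact conj_ofReal _
  have h1 : (V * D)ᴴ * G * (V * D) = 1 := by
    rw [Matrix.conjTranspose_mul, hDh]
    calc D * Vᴴ * G * (V * D) = D * (Vᴴ * G * V) * D := by simp only [Matrix.mul_assoc]
      _ = 1 := by
        rw [hV, hD, Matrix.diagonal_mul_diagonal, Matrix.diagonal_mul_diagonal,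
          ← Matrix.diagonal_one]
        congr 1
        ext i
        rw [← ofReal_mul, ← ofReal_mul]
        have h2 : (√(μ i)) * √(μ i) = μ i := Real.mul_self_sqrt (hμ i).le
        have h3 : √(μ i) ≠ 0 := (Real.sqrt_pos.2 (hμ i)).ne'
        rw [← ofReal_one, ofReal_inj]
        field_simp
        linarith
  have hu : IsUnit (V * D) := (Matrix.isUnit_iff_isUnit_det _).2
    (isUnit_iff_ne_zero.2 (det_ne_zero_of_congruence_eq_one h1))
  have hH' : ((V * D)ᴴ * H * (V * D)).PosDef := hH.conjTranspose_mul_mul_same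
    (Matrix.mulVec_injective_of_isUnit hu)
  obtain ⟨W, lam, hlam, hW1, hW⟩ := exists_unitary_diagonalization hH'
  refine ⟨V * D * W, lam, hlam, ?_, ?_⟩
  · rw [Matrix.conjTranspose_mul]
    calc Wᴴ * (V * D)ᴴ * G * (V * D * W) = Wᴴ * ((V * D)ᴴ * G * (V * D)) * W := by
          simp only [Matrix.mul_assoc]
      _ = 1 := by rw [h1, Matrix.mul_one, hW1]
  · rw [Matrix.conjTranspose_mul, ← hW]
    simp only [Matrix.mul_assoc]

/-- `tr (G⁻¹ H)` is invariant under congruence. -/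
theorem trace_inv_mul_congruence {G P : Matrix (Fin n) (Fin n) ℂ} (hP : P.det ≠ 0)
    (H : Matrix (Fin n) (Fin n) ℂ) :
    ((Pᴴ * G * P)⁻¹ * (Pᴴ * H * P)).trace = (G⁻¹ * H).trace := by
  have hP' : IsUnit P.det := isUnit_iff_ne_zero.2 hP
  have hPh : IsUnit Pᴴ.det := by
    rw [Matrix.det_conjTranspose]; exact hP'.star
  rw [Matrix.mul_inv_rev, Matrix.mul_inv_rev]
  calc (P⁻¹ * (G⁻¹ * Pᴴ⁻¹) * (Pᴴ * H * P)).trace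
      = (P⁻¹ * (G⁻¹ * (Pᴴ⁻¹ * Pᴴ) * H * P)).trace := by simp only [Matrix.mul_assoc]
    _ = (G⁻¹ * H).trace := by
      rw [Matrix.nonsing_inv_mul _ hPh, Matrix.mul_one, Matrix.trace_mul_comm, Matrix.mul_assoc,
        Matrix.mul_nonsing_inv _ hP', Matrix.mul_one]

theorem inv_eq_mul_conjTranspose {G P : Matrix (Fin n) (Fin n) ℂ} (h : Pᴴ * G * P = 1) :
    G⁻¹ = P * Pᴴ := by
  have h1 : P * (Pᴴ * G) = 1 := mul_eq_one_comm.1 h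
  refine Matrix.inv_eq_left_inv ?_
  rw [Matrix.mul_assoc, h1]

/-- For positive definite matrices, `tr (G⁻¹ H)` is a positive real number. -/
theorem trace_inv_mul_pos (hn : 0 < n) {G H : Matrix (Fin n) (Fin n) ℂ} (hG : G.PosDef)
    (hH : H.PosDef) : 0 < (G⁻¹ * H).trace.re ∧ ((G⁻¹ * H).trace.re : ℂ) = (G⁻¹ * H).trace := by
  obtain ⟨P, lam, hlam, h1, h2⟩ := exists_simultaneous_diagonalization hG hH
  have : Nonempty (Fin n) := ⟨⟨0, hn⟩⟩
  have ht : (G⁻¹ * H).trace = ((∑ i, lam i : ℝ) : ℂ) := by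
    rw [← trace_inv_mul_congruence (det_ne_zero_of_congruence_eq_one h1), h1, h2,
      inv_one, Matrix.one_mul, Matrix.trace_diagonal]
    push_cast
    rfl
  rw [ht, ofReal_re]
  exact ⟨Finset.sum_pos (fun i _ => hlam i) Finset.univ_nonempty, rfl⟩

/-- Since `G⁻¹ = P Pᴴ`, a diagonal entry of `G⁻¹` is the sum of the squared moduli in a row of `P`.
This bounds the adapted frame independently of `g'`. -/
theorem norm_le_of_congruence_eq_one {G P : Matrix (Fin n) (Fin n) ℂ} (h : Pᴴ * G * P = 1) {B : ℝ}
    (hB : ∀ a, ‖G⁻¹ a a‖ ≤ B) (a i : Fin n) : ‖P a i‖ ≤ 1 + B := by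
  have h1 : G⁻¹ a a = ((∑ i, normSq (P a i) : ℝ) : ℂ) := by
    rw [inv_eq_mul_conjTranspose h, Matrix.mul_apply]
    push_cast
    exact Finset.sum_congr rfl fun i _ => by rw [Matrix.conjTranspose_apply, ← mul_conj]; rfl
  have h2 : normSq (P a i) ≤ ∑ i, normSq (P a i) :=
    Finset.single_le_sum (f := fun i => normSq (P a i)) (fun _ _ => normSq_nonneg _)
      (Finset.mem_univ i)
  have h3 := hB a
  rw [h1, norm_real, Real.norm_eq_abs] at h3
  have h4 := (h2.trans (le_abs_self _)).trans h3
  rw [normSq_eq_norm_sq] at h4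
  nlinarith [sq_nonneg (‖P a i‖ - 1)]

theorem norm_conj_mul_mul_le {P X : Matrix (Fin n) (Fin n) ℂ} {D E : ℝ} (hP : ∀ i j, ‖P i j‖ ≤ D)
    (hX : ∀ i j, ‖X i j‖ ≤ E) (k l : Fin n) : ‖(Pᴴ * X * P) k l‖ ≤ n ^ 2 * (D ^ 2 * E) := by
  have hD : 0 ≤ D := (norm_nonneg _).trans (hP k k)
  have h1 : ∀ j, ‖(Pᴴ * X) k j‖ ≤ n * (D * E) := fun j => by
    rw [Matrix.mul_apply]
    calc _ ≤ ∑ _a : Fin n, D * E := norm_sum_le_of_le _ fun a _ => by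
          rw [norm_mul, Matrix.conjTranspose_apply, norm_star]
          exact mul_le_mul (hP _ _) (hX _ _) (norm_nonneg _) hD
      _ = _ := by simp
  rw [Matrix.mul_apply]
  calc _ ≤ ∑ _a : Fin n, n * (D * E) * D := norm_sum_le_of_le _ fun a _ => by
          rw [norm_mul]
          exact mul_le_mul (h1 _) (hP _ _) (norm_nonneg _) ((norm_nonneg _).trans (h1 a))
    _ = _ := by simp; ring

section Frame

variable {U : Set (Cn n)} {z p : Cn n}

theorem wirt_wirt_eq_sum {f : Cn n → ℂ} (hU : IsOpen U) (hf : ContDiffOn ℝ ∞ f U) (hz : z ∈ U)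
    (v w : Cn n) :
    wirt (-I) v (wirt I w f) z = ∑ a, ∑ b, v a * conj (w b) *
      wirt (-I) (Pi.single a 1) (wirt I (Pi.single b 1) f) z := by
  rw [wirt_neg_I_eq_sum]
  refine Finset.sum_congr rfl fun a _ => ?_
  have hd := fun b : Fin n =>
    differentiableAt_of_contDiffOn hU (wirt_contDiffOn hU hf I (Pi.single b 1)) hz
  have e : wirt (-I) (Pi.single a 1) (wirt I w f) z = wirt (-I) (Pi.single a 1)
      (fun y => ∑ b, conj (w b) * wirt I (Pi.single b 1) f y) z :=
    congrArg (fun q => wirt (-I) (Pi.single a 1) q z) (funext fun y => wirt_I_eq_sum w f y)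
  rw [e, wirt_sum _ fun b _ => (hd b).const_mul _, Finset.mul_sum]
  refine Finset.sum_congr rfl fun b _ => ?_
  rw [wirt_const_mul _ (hd b)]
  ring

/-- The complex Hessian of a function on `ℂⁿ`. -/
noncomputable def hessian (f : Cn n → ℂ) (z : Cn n) : Matrix (Fin n) (Fin n) ℂ :=
  Matrix.of fun i j => dWirt i (dbarWirt j f) z

theorem hessian_apply (f : Cn n → ℂ) (z : Cn n) (i j : Fin n) :
    hessian f z i j = wirt (-I) (Pi.single i 1) (wirt I (Pi.single j 1) f) z := by
  rw [hessian, Matrix.of_apply, dWirt_eq_wirt, dbarWirt_eq_wirt]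

theorem smoothMat_hessian {f : Cn n → ℂ} (hU : IsOpen U) (hf : ContDiffOn ℝ ∞ f U) :
    SmoothMat (hessian f) U := by
  intro i j
  simp only [hessian_apply]
  exact wirt_contDiffOn hU (wirt_contDiffOn hU hf _ _) _ _

/-- Congruence by a constant matrix `P` amounts to differentiating along the conjugated columns of
`P`. The conjugate is forced by the placement of `Pᴴ` on the holomorphic index. -/
theorem hessian_frame {f : Cn n → ℂ} (hU : IsOpen U) (hf : ContDiffOn ℝ ∞ f U) (hz : z ∈ U)
    (P : Matrix (Fin n) (Fin n) ℂ) (j k : Fin n) :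
    (Pᴴ * hessian f z * P) j k =
      wirt (-I) (fun a => conj (P a j)) (wirt I (fun a => conj (P a k)) f) z := by
  rw [wirt_wirt_eq_sum hU hf hz, Matrix.mul_apply, Finset.sum_comm]
  refine Finset.sum_congr rfl fun b _ => ?_
  rw [Matrix.mul_apply, Finset.sum_mul]
  refine Finset.sum_congr rfl fun a _ => ?_
  rw [hessian_apply, Matrix.conjTranspose_apply, conj_conj]
  simp only [RCLike.star_def]
  ring

theorem mwirt_frame {A : Cn n → Matrix (Fin n) (Fin n) ℂ} (hU : IsOpen U) (hA : SmoothMat A U)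
    (hz : z ∈ U) (P : Matrix (Fin n) (Fin n) ℂ) (s : ℂ) (v : Cn n) :
    mwirt s v (fun w => Pᴴ * A w * P) z = Pᴴ * mwirt s v A z * P := by
  have hP := SmoothMat.const P U
  have hPh := SmoothMat.const Pᴴ U
  rw [mwirt_mul hU (hPh.mul hA) hP hz, mwirt_mul hU hPh hA hz, mwirt_const, mwirt_const]
  simp

/-- The second-order estimate at a maximum point, in coordinates. -/
theorem trace_le_of_isLocalMax (hn : 0 < n) (hU : IsOpen U) (hp : p ∈ U)
    {G : Cn n → Matrix (Fin n) (Fin n) ℂ} (hG : SmoothMat G U) (hGpos : ∀ z ∈ U, (G z).PosDef)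
    {φ F : Cn n → ℝ} (hφ : ContDiffOn ℝ ∞ φ U) (hF : ContDiffOn ℝ ∞ F U)
    (hHpos : ∀ z ∈ U, (G z + hessian (fun w => (φ w : ℂ)) z).PosDef)
    (hMA : ∀ z ∈ U, (G z + hessian (fun w => (φ w : ℂ)) z).det = exp (F z) * (G z).det)
    {B K : ℝ}
    (hg1 : ∀ a b c, ‖wirt (-I) (Pi.single a 1) (fun w => G w b c) p‖ ≤ B)
    (hg2 : ∀ a b c d, ‖hessian (fun w => G w c d) p a b‖ ≤ B)
    (hginv : ∀ a, ‖(G p)⁻¹ a a‖ ≤ B)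
    (hFK : |F p| ≤ K)
    (hΔF : -K ≤ ((G p)⁻¹ * hessian (fun w => (F w : ℂ)) p).trace.re)
    {m A : ℝ} (hm : ∀ z ∈ U, m ≤ φ z) (hA : A = laplacianConst n (n ^ 4 * (1 + B) ^ 5) K + 2)
    (hmax : IsLocalMax (fun z => Real.log
      ((G z)⁻¹ * (G z + hessian (fun w => (φ w : ℂ)) z)).trace.re - A * φ z + (φ z - m + 1)⁻¹) p) :
    (φ p - m + 1)⁻¹ ^ 3 * ((G p)⁻¹ * (G p + hessian (fun w => (φ w : ℂ)) p)).trace.re ^ 2 ≤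
        ((A + 1) * (2 * n * (n ^ 4 * (1 + B) ^ 5))) ^ 2 ∨
      ((G p)⁻¹ * (G p + hessian (fun w => (φ w : ℂ)) p)).trace.re ≤
        n * (Real.exp K * (1 + (A + 1) * n) ^ n) := by
  have hφc : ContDiffOn ℝ ∞ (fun w => (φ w : ℂ)) U := ofRealCLM.contDiff.comp_contDiffOn hφ
  have hFc : ContDiffOn ℝ ∞ (fun w => (F w : ℂ)) U := ofRealCLM.contDiff.comp_contDiffOn hF
  obtain ⟨P, lam, hlam, hP1, hP2⟩ := exists_simultaneous_diagonalization (hGpos p hp) (hHpos p hp)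
  have hPd := det_ne_zero_of_congruence_eq_one hP1
  have hPb := norm_le_of_congruence_eq_one hP1 hginv
  have i0 : Fin n := ⟨0, hn⟩
  have hB0 : 0 ≤ B := (norm_nonneg _).trans (hginv i0)
  have hn1 : (1 : ℝ) ≤ n := by exact_mod_cast hn
  have hinj : Injective P.mulVec := Matrix.mulVec_injective_of_isUnit
    ((Matrix.isUnit_iff_isUnit_det P).2 (isUnit_iff_ne_zero.2 hPd))
  have hHs : SmoothMat (fun z => G z + hessian (fun w => (φ w : ℂ)) z) U :=
    hG.add (smoothMat_hessian hU hφc)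
  have hfr : ∀ {X : Cn n → Matrix (Fin n) (Fin n) ℂ}, SmoothMat X U →
      SmoothMat (fun z => Pᴴ * X z * P) U := fun hX =>
    ((SmoothMat.const Pᴴ U).mul hX).mul (SmoothMat.const P U)
  have hGpos' : ∀ z ∈ U, (Pᴴ * G z * P).PosDef := fun z hz =>
    (hGpos z hz).conjTranspose_mul_mul_same hinj
  have hHpos' : ∀ z ∈ U, (Pᴴ * (G z + hessian (fun w => (φ w : ℂ)) z) * P).PosDef := fun z hz =>
    (hHpos z hz).conjTranspose_mul_mul_same hinj
  have hvb : ∀ i a, ‖conj (P a i)‖ ≤ 1 + B := fun i a => by simpa using hPb a i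
  have hX1 : ∀ i b c, ‖mwirt (-I) (fun a => conj (P a i)) G p b c‖ ≤ n * ((1 + B) * B) := by
    intro i b c
    rw [mwirt, Matrix.of_apply, wirt_neg_I_eq_sum]
    calc _ ≤ ∑ _a : Fin n, (1 + B) * B := norm_sum_le_of_le _ fun a _ => by
          rw [norm_mul]
          exact mul_le_mul (hvb i a) (hg1 a b c) (norm_nonneg _) (by linarith)
      _ = _ := by simp
  have hX2 : ∀ i b c, ‖mwirt (-I) (fun a => conj (P a i)) (mwirt I (fun a => conj (P a i)) G) p b c‖
      ≤ n ^ 2 * ((1 + B) ^ 2 * B) := by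
    intro i b c
    have e : mwirt (-I) (fun a => conj (P a i)) (mwirt I (fun a => conj (P a i)) G) p b c =
        (Pᴴ * hessian (fun w => G w b c) p * P) i i := by
      rw [hessian_frame hU (hG b c) hp]; rfl
    rw [e]
    exact norm_conj_mul_mul_le hPb (fun a d => hg2 a d b c) i i
  -- In the frame, first derivatives of the metric are bounded by `n³ (1 + B)³ B` and second ones by
  -- `n⁴ (1 + B)⁴ B`. The constant `n⁴ (1 + B)⁵` dominates both.
  have hpow : ∀ k : ℕ, k ≤ 4 → (n : ℝ) ^ k * ((1 + B) ^ k * B) ≤ n ^ 4 * (1 + B) ^ 5 := by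
    intro k hk
    have e1 : (n : ℝ) ^ k ≤ n ^ 4 := pow_le_pow_right₀ hn1 hk
    have e2 : (1 + B) ^ k * B ≤ (1 + B) ^ 5 := by
      calc (1 + B) ^ k * B ≤ (1 + B) ^ 4 * (1 + B) := by
            gcongr
            · linarith
            · linarith
        _ = _ := by ring
    exact mul_le_mul e1 e2 (by positivity) (by positivity)
  have hu : ∀ z ∈ U, ((((G z)⁻¹ * (G z + hessian (fun w => (φ w : ℂ)) z)).trace.re : ℝ) : ℂ) =
      ((Pᴴ * G z * P)⁻¹ * (Pᴴ * (G z + hessian (fun w => (φ w : ℂ)) z) * P)).trace := fun z hz => by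
    rw [trace_inv_mul_congruence hPd]
    exact (trace_inv_mul_pos hn (hGpos z hz) (hHpos z hz)).2
  refine trace_le_of_isLocalMax_frame hn hU hp (hfr hG) (hfr hHs)
    (fun z hz => (hGpos' z hz).isHermitian) (fun z hz => (hHpos' z hz).isHermitian)
    (fun z hz => (hGpos' z hz).det_pos.ne') (fun z hz => (hHpos' z hz).det_pos.ne') hφ hF
    (l := fun j a => conj (P a j)) (fun z hz j k => ?_) (fun z hz => ?_) hP1 hlam hP2
    (u := fun z => ((G z)⁻¹ * (G z + hessian (fun w => (φ w : ℂ)) z)).trace.re) hu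
    (fun z hz => (trace_inv_mul_pos hn (hGpos z hz) (hHpos z hz)).1) (by positivity)
    (fun i j k => ?_) (fun i k => ?_) hFK ?_ hm hA hmax
  · rw [← hessian_frame hU hφc hz, Matrix.mul_add, Matrix.add_mul, Matrix.add_apply]
  · rw [Matrix.det_mul, Matrix.det_mul, Matrix.det_mul, Matrix.det_mul, hMA z hz]
    ring
  · have e := congrFun (congrFun (mwirt_frame hU hG hp P (-I) fun a => conj (P a i)) j) k
    rw [mwirt, Matrix.of_apply] at e
    rw [e]
    refine (norm_conj_mul_mul_le hPb (hX1 i) j k).trans (le_trans (le_of_eq ?_) (hpow 3 (by norm_num)))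
    ring
  · have e1 : wirt (-I) (fun a => conj (P a i)) (wirt I (fun a => conj (P a i))
        fun w => (Pᴴ * G w * P) k k) p =
        mwirt (-I) (fun a => conj (P a i)) (fun w => Pᴴ * mwirt I (fun a => conj (P a i)) G w * P)
          p k k := by
      rw [mwirt, Matrix.of_apply]
      exact wirt_congr hU hp fun w hw =>
        congrFun (congrFun (mwirt_frame hU hG hw P I fun a => conj (P a i)) k) k
    rw [e1, mwirt_frame hU (hG.mwirt hU _ _) hp]
    refine (norm_conj_mul_mul_le hPb (hX2 i) k k).trans (le_trans (le_of_eq ?_) (hpow 4 le_rfl))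
    ring
  -- In a `g`-orthonormal frame the Chern Laplacian is the plain sum of the `∂_k ∂̄_k`, because `G⁻¹
  -- = P Pᴴ`.
  · have e : ∑ k, (wirt (-I) (fun a => conj (P a k)) (wirt I (fun a => conj (P a k))
        fun w => (F w : ℂ)) p).re = ((G p)⁻¹ * hessian (fun w => (F w : ℂ)) p).trace.re := by
      rw [inv_eq_mul_conjTranspose hP1, Matrix.mul_assoc, Matrix.trace_mul_comm]
      simp only [Matrix.trace, re_sum, Matrix.diag_apply, hessian_frame hU hFc hp]
    rw [e]
    exact hΔF

end Frame

end HermitianMA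

/-! ### Holomorphic changes of charts and invariance of the trace -/

namespace HermitianMA

open Complex

section HolomorphicChange

variable {n : ℕ} {V W : Set (Cn n)} {f : Cn n → ℂ} {ψ : Cn n → Cn n} {z : Cn n}

/-- The complex differential of `ψ` commutes with multiplication by `√-1`, so the type of the
derivative is preserved. -/
theorem wirt_comp_holomorphic (hf : DifferentiableAt ℝ f (ψ z)) (hψ : DifferentiableAt ℂ ψ z)
    (s : ℂ) (v : Cn n) :
    wirt s v (fun w => f (ψ w)) z = wirt s (fderiv ℂ ψ z v) f (ψ z) := by
  have h : HasFDerivAt (fun w => f (ψ w))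
      ((fderiv ℝ f (ψ z)).comp ((fderiv ℂ ψ z).restrictScalars ℝ)) z :=
    hf.hasFDerivAt.comp z (hψ.hasFDerivAt.restrictScalars ℝ)
  rw [wirt, wirt, h.fderiv]
  simp

theorem wirt_neg_I_conj_holomorphic {q : Cn n → ℂ} (hq : DifferentiableAt ℂ q z) (v : Cn n) :
    wirt (-I) v (fun w => conj (q w)) z = 0 := by
  have h := conj_wirt (s := I) (v := v) (hq.restrictScalars ℝ)
  rw [conj_I] at h
  rw [← h, wirt, (hq.fderiv_restrictScalars ℝ)]
  simp only [ContinuousLinearMap.coe_restrictScalars', map_smul, smul_eq_mul]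
  rw [← mul_assoc, I_mul_I]
  simp

/-- The complex Hessian under a holomorphic change of variables. -/
theorem hessian_comp_holomorphic (hV : IsOpen V) (hf : ContDiffOn ℝ ∞ f V) (hW : IsOpen W)
    (hψ : ContDiffOn ℂ ω ψ W) (hmaps : MapsTo ψ W V) (hz : z ∈ W) :
    hessian (fun w => f (ψ w)) z =
      (Matrix.of fun a i => conj (fderiv ℂ ψ z (Pi.single i 1) a))ᴴ * hessian f (ψ z) *
        (Matrix.of fun a i => conj (fderiv ℂ ψ z (Pi.single i 1) a)) := by
  have hψd : ∀ w ∈ W, DifferentiableAt ℂ ψ w := fun w hw =>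
    (hψ.contDiffAt (hW.mem_nhds hw)).differentiableAt (by simp)
  ext i j
  rw [hessian_frame hV hf (hmaps hz), hessian_apply]
  simp only [Matrix.of_apply, conj_conj]
  set vi : Cn n := Pi.single i 1
  set vj : Cn n := Pi.single j 1
  have e1 : ∀ w ∈ W, wirt I vj (fun w => f (ψ w)) w =
      ∑ b, conj (fderiv ℂ ψ w vj b) * wirt I (Pi.single b 1) f (ψ w) := fun w hw => by
    rw [wirt_comp_holomorphic (differentiableAt_of_contDiffOn hV hf (hmaps hw)) (hψd w hw),
      wirt_I_eq_sum]
  have hJ : ∀ b, DifferentiableAt ℂ (fun w => fderiv ℂ ψ w vj b) z := fun b => by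
    have h1 : ContDiffAt ℂ 1 (fderiv ℂ ψ) z :=
      (hψ.contDiffAt (hW.mem_nhds hz)).fderiv_right (m := 1) (by simp)
    have h2 : DifferentiableAt ℂ (fun w => fderiv ℂ ψ w vj) z :=
      (h1.differentiableAt one_ne_zero).clm_apply (differentiableAt_const vj)
    exact differentiableAt_pi.1 h2 b
  have hJc : ∀ b, DifferentiableAt ℝ (fun w => conj (fderiv ℂ ψ w vj b)) z := fun b =>
    conjCLE.differentiableAt.comp z ((hJ b).restrictScalars ℝ)
  have hfb : ∀ b : Fin n, DifferentiableAt ℝ (wirt I (Pi.single b 1) f) (ψ z) := fun b =>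
    differentiableAt_of_contDiffOn hV (wirt_contDiffOn hV hf _ _) (hmaps hz)
  have hfbc : ∀ b : Fin n, DifferentiableAt ℝ (fun w => wirt I (Pi.single b 1) f (ψ w)) z :=
    fun b => (hfb b).comp z ((hψd z hz).restrictScalars ℝ)
  rw [wirt_congr hW hz e1, wirt_sum _ fun b _ => (hJc b).fun_mul (hfbc b)]
  -- The coefficient is antiholomorphic, so `∂` does not see it. Thus no first order term survives
  -- and the complex Hessian transforms as a tensor.
  have e2 : ∀ b, wirt (-I) vi (fun w => conj (fderiv ℂ ψ w vj b) * wirt I (Pi.single b 1) f (ψ w)) z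
      = conj (fderiv ℂ ψ z vj b) *
        wirt (-I) (fderiv ℂ ψ z vi) (wirt I (Pi.single b 1) f) (ψ z) := fun b => by
    rw [wirt_mul (hJc b) (hfbc b), wirt_neg_I_conj_holomorphic (hJ b),
      wirt_comp_holomorphic (hfb b) (hψd z hz)]
    ring
  simp only [e2]
  have e3 : wirt (-I) (fderiv ℂ ψ z vi) (wirt I (fderiv ℂ ψ z vj) f) (ψ z) =
      wirt (-I) (fderiv ℂ ψ z vi)
        (fun y => ∑ b, conj (fderiv ℂ ψ z vj b) * wirt I (Pi.single b 1) f y) (ψ z) :=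
    congrArg (fun q => wirt (-I) (fderiv ℂ ψ z vi) q (ψ z)) (funext fun y => wirt_I_eq_sum _ f y)
  have e4 : (fun a => fderiv ℂ ψ z vi a) = fderiv ℂ ψ z vi := rfl
  have e5 : (fun a => fderiv ℂ ψ z vj a) = fderiv ℂ ψ z vj := rfl
  rw [e4, e5, e3, wirt_sum _ fun b _ => (hfb b).const_mul _]
  exact Finset.sum_congr rfl fun b _ => (wirt_const_mul _ (hfb b)).symm

end HolomorphicChange

section Charts

variable {n : ℕ} {M : Type*} [TopologicalSpace M]

/-- The domain of the transition map `e ∘ e'⁻¹`. -/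
theorem isOpen_transition (e e' : OpenPartialHomeomorph M (Cn n)) :
    IsOpen (e'.target ∩ e'.symm ⁻¹' e.source) :=
  e'.isOpen_inter_preimage_symm e.open_source

variable [ChartedSpace (Cn n) M] {e e' : OpenPartialHomeomorph M (Cn n)} {z : Cn n}

theorem contDiffOn_transition (he : e ∈ holCharts n M) (he' : e' ∈ holCharts n M) :
    ContDiffOn ℂ ω (fun z => e (e'.symm z)) (e'.target ∩ e'.symm ⁻¹' e.source) := by
  rw [← contMDiffOn_iff_contDiffOn]
  exact (contMDiffOn_of_mem_maximalAtlas he).comp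
    ((contMDiffOn_symm_of_mem_maximalAtlas he').mono inter_subset_left) fun z hz => hz.2

/-- The differential of `e⁻¹`, as a map of `ℂⁿ`. -/
noncomputable def symmDeriv (e : OpenPartialHomeomorph M (Cn n)) (z : Cn n) : Cn n →L[ℂ] Cn n :=
  mfderiv 𝓘(ℂ, Cn n) 𝓘(ℂ, Cn n) e.symm z

theorem symmDeriv_transition (he : e ∈ holCharts n M) (he' : e' ∈ holCharts n M)
    (hz : z ∈ e'.target ∩ e'.symm ⁻¹' e.source) :
    symmDeriv e' z = (symmDeriv e (e (e'.symm z))).comp (fderiv ℂ (fun z => e (e'.symm z)) z) := by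
  have hopen := isOpen_transition e e'
  have h1 : (e'.symm : Cn n → M) =ᶠ[nhds z] e.symm ∘ fun z => e (e'.symm z) := by
    filter_upwards [hopen.mem_nhds hz] with w hw
    simp only [comp_apply]
    rw [e.left_inv hw.2]
  have h2 : MDifferentiableAt 𝓘(ℂ, Cn n) 𝓘(ℂ, Cn n) e.symm (e (e'.symm z)) :=
    (contMDiffAt_symm_of_mem_maximalAtlas he (e.map_source hz.2)).mdifferentiableAt (by simp)
  have h3 : DifferentiableAt ℂ (fun z => e (e'.symm z)) z :=
    ((contDiffOn_transition he he').contDiffAt (hopen.mem_nhds hz)).differentiableAt (by simp)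
  rw [symmDeriv, h1.mfderiv_eq, mfderiv_comp z h2 h3.mdifferentiableAt, mfderiv_eq_fderiv]
  rfl

theorem symmDeriv_injective (he : e ∈ holCharts n M) (hz : z ∈ e.target) :
    Injective (symmDeriv e z) := by
  have h1 : MDifferentiableAt 𝓘(ℂ, Cn n) 𝓘(ℂ, Cn n) e.symm z :=
    (contMDiffAt_symm_of_mem_maximalAtlas he hz).mdifferentiableAt (by simp)
  have h2 : MDifferentiableAt 𝓘(ℂ, Cn n) 𝓘(ℂ, Cn n) e (e.symm z) :=
    (contMDiffAt_of_mem_maximalAtlas he (e.map_target hz)).mdifferentiableAt (by simp)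
  have h3 : (e ∘ e.symm : Cn n → Cn n) =ᶠ[nhds z] id := by
    filter_upwards [e.open_target.mem_nhds hz] with w hw using e.right_inv hw
  have h4 := mfderiv_comp z h2 h1
  rw [h3.mfderiv_eq, mfderiv_id] at h4
  set T : Cn n →L[ℂ] Cn n := mfderiv 𝓘(ℂ, Cn n) 𝓘(ℂ, Cn n) e (e.symm z) with hT
  have h5 : ∀ v, T (symmDeriv e z v) = v := fun v =>
    (congrArg (fun T : Cn n →L[ℂ] Cn n => T v) h4).symm
  exact LeftInverse.injective h5

variable [IsManifold 𝓘(ℂ, Cn n) ω M]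

theorem chartAt_mem_holCharts (x : M) : chartAt (Cn n) x ∈ holCharts n M :=
  IsManifold.chart_mem_maximalAtlas x

/-- Smoothness on `M` is tested in the preferred charts; the transition to any other holomorphic
chart is holomorphic, hence smooth in the real sense. -/
theorem contDiffOn_comp_symm {f : M → ℝ} (hf : ContMDiff 𝓘(ℝ, Cn n) 𝓘(ℝ, ℝ) ∞ f)
    (he : e ∈ holCharts n M) : ContDiffOn ℝ ∞ (fun z => f (e.symm z)) e.target := by
  intro z hz
  refine ContDiffAt.contDiffWithinAt ?_
  set c := chartAt (Cn n) (e.symm z) with hc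
  have hcz : e.symm z ∈ c.source := mem_chart_source _ _
  have h1 := (contMDiffAt_iff.1 (hf (e.symm z))).2
  simp only [mfld_simps] at h1
  rw [contDiffWithinAt_univ] at h1
  have hopen := isOpen_transition c e
  have hmem : z ∈ e.target ∩ e.symm ⁻¹' c.source := ⟨hz, hcz⟩
  have h2 : ContDiffAt ℝ ∞ (fun z => c (e.symm z)) z :=
    (((contDiffOn_transition (chartAt_mem_holCharts _) he).contDiffAt
      (hopen.mem_nhds hmem)).restrict_scalars ℝ).of_le le_top
  have h1' : ContDiffAt ℝ ∞ (fun y => f (c.symm y)) (c (e.symm z)) := h1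
  have h3 : ContDiffAt ℝ ∞ (fun z => f (c.symm (c (e.symm z)))) z :=
    ContDiffAt.comp (g := fun y => f (c.symm y)) z h1' h2
  refine h3.congr_of_eventuallyEq ?_
  filter_upwards [hopen.mem_nhds hmem] with w hw
  rw [c.left_inv hw.2]

end Charts

section Metric

variable {n : ℕ} {M : Type*} [TopologicalSpace M] [ChartedSpace (Cn n) M]
  {e e' : OpenPartialHomeomorph M (Cn n)} {z : Cn n} (g : HermitianMetric n M)

namespace HermitianMetric

/-- The metric at `x`, as a sesquilinear form on `ℂⁿ`. -/
def formAt (x : M) : Cn n →ₗ[ℂ] Cn n →ₗ⋆[ℂ] ℂ := g.form x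

theorem formAt_symm (x : M) (v w : Cn n) : g.formAt x w v = conj (g.formAt x v w) := g.symm x v w

theorem formAt_pos (x : M) {v : Cn n} (hv : v ≠ 0) : 0 < (g.formAt x v v).re := g.pos x v hv

theorem coeff_apply (e : OpenPartialHomeomorph M (Cn n)) (z : Cn n) (i j : Fin n) :
    g.coeff e z i j = g.formAt (e.symm z) (symmDeriv e z (Pi.single i 1))
      (symmDeriv e z (Pi.single j 1)) := rfl

theorem smoothMat_coeff (he : e ∈ holCharts n M) : SmoothMat (g.coeff e) e.target :=
  fun i j => g.smooth e he i j

theorem formAt_sum (x : M) (T : Cn n →L[ℂ] Cn n) (v w : Cn n) :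
    g.formAt x (T v) (T w) = ∑ a, ∑ b, v a * conj (w b) *
      g.formAt x (T (Pi.single a 1)) (T (Pi.single b 1)) := by
  conv_lhs => rw [eq_sum_single v, eq_sum_single w]
  simp only [map_sum, map_smul, LinearMap.sum_apply, LinearMap.smul_apply, smul_eq_mul,
    LinearMap.map_smulₛₗ, Finset.mul_sum]
  rw [Finset.sum_comm]
  exact Finset.sum_congr rfl fun a _ => Finset.sum_congr rfl fun b _ => by ring

theorem coeff_posDef (he : e ∈ holCharts n M) (hz : z ∈ e.target) : (g.coeff e z).PosDef := by
  refine Matrix.PosDef.of_dotProduct_mulVec_pos ?_ fun x hx => ?_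
  · ext i j
    rw [Matrix.conjTranspose_apply, coeff_apply, coeff_apply, formAt_symm]
    exact conj_conj _
  -- The coefficients are linear in the first index, whereas `star x` stands on the left in the
  -- matrix form; the vector to insert in the metric is therefore the conjugate of `x`.
  · have hx' : (fun a => conj (x a)) ≠ (0 : Cn n) := fun h => hx (funext fun a => by
      have := congrFun h a
      simpa using this)
    have h0 : symmDeriv e z (fun a => conj (x a)) ≠ 0 := fun h =>
      hx' (symmDeriv_injective he hz (by rw [h, map_zero]))
    have h1 : star x ⬝ᵥ (g.coeff e z *ᵥ x) = g.formAt (e.symm z)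
        (symmDeriv e z (fun a => conj (x a))) (symmDeriv e z (fun a => conj (x a))) := by
      rw [formAt_sum]
      simp only [dotProduct, Matrix.mulVec, Finset.mul_sum]
      refine Finset.sum_congr rfl fun a _ => Finset.sum_congr rfl fun b _ => ?_
      rw [coeff_apply, conj_conj, Pi.star_apply, RCLike.star_def]
      ring
    have h2 := g.formAt_symm (e.symm z) (symmDeriv e z (fun a => conj (x a)))
      (symmDeriv e z (fun a => conj (x a)))
    rw [h1, Complex.pos_iff]
    exact ⟨g.formAt_pos _ h0, (conj_eq_iff_im.1 h2.symm).symm⟩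

/-- The coefficients of the metric under a change of charts. -/
theorem coeff_transition (he : e ∈ holCharts n M) (he' : e' ∈ holCharts n M)
    (hz : z ∈ e'.target ∩ e'.symm ⁻¹' e.source) :
    g.coeff e' z =
      (Matrix.of fun a i => conj (fderiv ℂ (fun z => e (e'.symm z)) z (Pi.single i 1) a))ᴴ *
        g.coeff e (e (e'.symm z)) *
        (Matrix.of fun a i => conj (fderiv ℂ (fun z => e (e'.symm z)) z (Pi.single i 1) a)) := by
  ext i j
  rw [coeff_apply, symmDeriv_transition he he' hz, ContinuousLinearMap.comp_apply,
    ContinuousLinearMap.comp_apply, formAt_sum, Matrix.mul_apply, Finset.sum_comm]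
  refine Finset.sum_congr rfl fun b _ => ?_
  rw [Matrix.mul_apply, Finset.sum_mul]
  refine Finset.sum_congr rfl fun a _ => ?_
  rw [coeff_apply, e.left_inv hz.2]
  simp only [Matrix.conjTranspose_apply, Matrix.of_apply, RCLike.star_def, conj_conj]
  ring

theorem coeff'_eq (φ : M → ℝ) (e : OpenPartialHomeomorph M (Cn n)) (z : Cn n) :
    g.coeff' φ e z = g.coeff e z + hessian (fun w => (φ (e.symm w) : ℂ)) z := rfl

variable [IsManifold 𝓘(ℂ, Cn n) ω M]

theorem hessian_transition {φ : M → ℝ} (hφ : ContMDiff 𝓘(ℝ, Cn n) 𝓘(ℝ, ℝ) ∞ φ)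
    (he : e ∈ holCharts n M) (he' : e' ∈ holCharts n M)
    (hz : z ∈ e'.target ∩ e'.symm ⁻¹' e.source) :
    hessian (fun w => (φ (e'.symm w) : ℂ)) z =
      (Matrix.of fun a i => conj (fderiv ℂ (fun z => e (e'.symm z)) z (Pi.single i 1) a))ᴴ *
        hessian (fun w => (φ (e.symm w) : ℂ)) (e (e'.symm z)) *
        (Matrix.of fun a i => conj (fderiv ℂ (fun z => e (e'.symm z)) z (Pi.single i 1) a)) := by
  have hopen := isOpen_transition e e'
  have hφc : ContDiffOn ℝ ∞ (fun w => (φ (e.symm w) : ℂ)) e.target :=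
    ofRealCLM.contDiff.comp_contDiffOn (contDiffOn_comp_symm hφ he)
  rw [← hessian_comp_holomorphic e.open_target hφc hopen (contDiffOn_transition he he')
    (fun w hw => e.map_source hw.2) hz]
  have heq : EqOn (fun w => (φ (e'.symm w) : ℂ)) (fun w => (φ (e.symm (e (e'.symm w))) : ℂ))
      (e'.target ∩ e'.symm ⁻¹' e.source) := fun w hw => by
    simp only
    rw [e.left_inv hw.2]
  ext i j
  rw [hessian_apply, hessian_apply]
  exact wirt_congr hopen hz fun w hw => wirt_congr hopen hw heq

/-- The trace `tr_g g'` does not depend on the chart. -/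
theorem traceMetricIn_eq {φ : M → ℝ} (hφ : ContMDiff 𝓘(ℝ, Cn n) 𝓘(ℝ, ℝ) ∞ φ)
    (he : e ∈ holCharts n M) (he' : e' ∈ holCharts n M) {x : M} (hx : x ∈ e.source)
    (hx' : x ∈ e'.source) : g.traceMetricIn e' φ (e' x) = g.traceMetricIn e φ (e x) := by
  have hz : e' x ∈ e'.target ∩ e'.symm ⁻¹' e.source :=
    ⟨e'.map_source hx', by rw [mem_preimage, e'.left_inv hx']; exact hx⟩
  have h1 := g.coeff_transition he he' hz
  have h2 : g.coeff' φ e' (e' x) =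
      (Matrix.of fun a i => conj (fderiv ℂ (fun z => e (e'.symm z)) (e' x) (Pi.single i 1) a))ᴴ *
        g.coeff' φ e (e x) *
        (Matrix.of fun a i => conj (fderiv ℂ (fun z => e (e'.symm z)) (e' x) (Pi.single i 1) a)) := by
    rw [coeff'_eq, coeff'_eq, h1, hessian_transition hφ he he' hz, Matrix.mul_add, Matrix.add_mul,
      e'.left_inv hx']
  rw [e'.left_inv hx'] at h1
  have hd := (g.coeff_posDef he' hz.1).det_pos.ne'
  rw [h1, Matrix.det_mul] at hd
  rw [traceMetricIn, traceMetricIn, traceIn, traceIn, h1, h2,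
    trace_inv_mul_congruence (right_ne_zero_of_mul hd)]

end HermitianMetric

end Metric

end HermitianMA

/-! ### Uniform constants on a compact manifold and the global estimate -/

namespace HermitianMA

open Complex

section Global

variable {n : ℕ} {M : Type*} [TopologicalSpace M] [ChartedSpace (Cn n) M]

namespace HermitianMetric

/-- The first and mixed second derivatives of the coefficients of the metric in the chart `e`, and
the diagonal entries of the inverse, are bounded by `B` at the point `z`. -/
def JetBound (g : HermitianMetric n M) (e : OpenPartialHomeomorph M (Cn n)) (z : Cn n) (B : ℝ) :
    Prop :=
  (∀ a b c, ‖wirt (-I) (Pi.single a 1) (fun w => g.coeff e w b c) z‖ ≤ B) ∧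
  (∀ a b c d, ‖hessian (fun w => g.coeff e w c d) z a b‖ ≤ B) ∧
  ∀ a, ‖(g.coeff e z)⁻¹ a a‖ ≤ B

variable {g : HermitianMetric n M} {e : OpenPartialHomeomorph M (Cn n)}

theorem JetBound.mono {z : Cn n} {B B' : ℝ} (h : g.JetBound e z B) (hB : B ≤ B') :
    g.JetBound e z B' :=
  ⟨fun a b c => (h.1 a b c).trans hB, fun a b c d => (h.2.1 a b c d).trans hB,
    fun a => (h.2.2 a).trans hB⟩

/-- Each of the finitely many jet components is continuous, so near `x` it stays below its norm at
`x` plus one. The sum of these nonnegative numbers serves as a common bound. -/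
theorem eventually_jetBound (he : e ∈ holCharts n M) {x : M} (hx : x ∈ e.source) :
    ∃ B : ℝ, ∀ᶠ y in nhds x, y ∈ e.source ∧ g.JetBound e (e y) B := by
  have hG := g.smoothMat_coeff he
  have key : ∀ f : Cn n → ℂ, ContDiffOn ℝ ∞ f e.target →
      ∀ᶠ y in nhds x, ‖f (e y)‖ < ‖f (e x)‖ + 1 := by
    intro f hf
    have h1 : ContinuousAt f (e x) :=
      hf.continuousOn.continuousAt (e.open_target.mem_nhds (e.map_source hx))
    have h2 : ContinuousAt (fun y => ‖f (e y)‖) x :=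
      (ContinuousAt.comp (g := f) h1 (e.continuousAt hx)).norm
    exact h2.eventually_lt_const (lt_add_one _)
  have hs1 : ∀ a b c, ContDiffOn ℝ ∞
      (wirt (-I) (Pi.single a 1) (fun w => g.coeff e w b c)) e.target :=
    fun a b c => wirt_contDiffOn e.open_target (hG b c) _ _
  have hs2 : ∀ a b c d, ContDiffOn ℝ ∞
      (fun z => hessian (fun w => g.coeff e w c d) z a b) e.target :=
    fun a b c d => smoothMat_hessian e.open_target (hG c d) a b
  have hs3 : ∀ a, ContDiffOn ℝ ∞ (fun z => (g.coeff e z)⁻¹ a a) e.target :=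
    fun a => hG.inv (fun z hz => (g.coeff_posDef he hz).det_pos.ne') a a
  set b1 : Fin n → Fin n → Fin n → ℝ := fun a b c =>
    ‖wirt (-I) (Pi.single a 1) (fun w => g.coeff e w b c) (e x)‖ + 1 with hb1
  set b2 : Fin n → Fin n → Fin n → Fin n → ℝ := fun a b c d =>
    ‖hessian (fun w => g.coeff e w c d) (e x) a b‖ + 1 with hb2
  set b3 : Fin n → ℝ := fun a => ‖(g.coeff e (e x))⁻¹ a a‖ + 1 with hb3
  have p1 : ∀ a b c, 0 ≤ b1 a b c := fun a b c => by positivity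
  have p2 : ∀ a b c d, 0 ≤ b2 a b c d := fun a b c d => by positivity
  have p3 : ∀ a, 0 ≤ b3 a := fun a => by positivity
  have q1 : 0 ≤ ∑ t : Fin n × Fin n × Fin n, b1 t.1 t.2.1 t.2.2 :=
    Finset.sum_nonneg fun _ _ => p1 _ _ _
  have q2 : 0 ≤ ∑ t : Fin n × Fin n × Fin n × Fin n, b2 t.1 t.2.1 t.2.2.1 t.2.2.2 :=
    Finset.sum_nonneg fun _ _ => p2 _ _ _ _
  have q3 : 0 ≤ ∑ a, b3 a := Finset.sum_nonneg fun _ _ => p3 _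
  refine ⟨∑ t : Fin n × Fin n × Fin n, b1 t.1 t.2.1 t.2.2 +
    ∑ t : Fin n × Fin n × Fin n × Fin n, b2 t.1 t.2.1 t.2.2.1 t.2.2.2 + ∑ a, b3 a, ?_⟩
  have E1 := Filter.eventually_all.2 fun a => Filter.eventually_all.2 fun b =>
    Filter.eventually_all.2 fun c => key _ (hs1 a b c)
  have E2 := Filter.eventually_all.2 fun a => Filter.eventually_all.2 fun b =>
    Filter.eventually_all.2 fun c => Filter.eventually_all.2 fun d => key _ (hs2 a b c d)
  have E3 := Filter.eventually_all.2 fun a => key _ (hs3 a)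
  filter_upwards [E1, E2, E3, e.open_source.mem_nhds hx] with y h1 h2 h3 hy
  refine ⟨hy, fun a b c => (h1 a b c).le.trans ?_, fun a b c d => (h2 a b c d).le.trans ?_,
    fun a => (h3 a).le.trans ?_⟩
  · have := Finset.single_le_sum (f := fun t : Fin n × Fin n × Fin n => b1 t.1 t.2.1 t.2.2)
      (fun _ _ => p1 _ _ _) (Finset.mem_univ (a, b, c))
    simp only [hb1] at this q2 q3 ⊢
    linarith
  · have := Finset.single_le_sum
      (f := fun t : Fin n × Fin n × Fin n × Fin n => b2 t.1 t.2.1 t.2.2.1 t.2.2.2)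
      (fun _ _ => p2 _ _ _ _) (Finset.mem_univ (a, b, c, d))
    simp only [hb2] at this q1 q3 ⊢
    linarith
  · have := Finset.single_le_sum (f := b3) (fun _ _ => p3 _) (Finset.mem_univ a)
    simp only [hb3] at this q1 q2 ⊢
    linarith

variable [IsManifold 𝓘(ℂ, Cn n) ω M]

/-- On a compact manifold the jets of the metric are uniformly bounded in suitable charts. -/
theorem exists_uniform_jetBound [CompactSpace M] (g : HermitianMetric n M) :
    ∃ B : ℝ, 0 ≤ B ∧ ∀ x : M, ∃ e ∈ holCharts n M, x ∈ e.source ∧ g.JetBound e (e x) B := by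
  -- The property asks for one bound on all of `s`, with a chart that may depend on the point. It
  -- passes to subsets, and to unions by taking the maximum.
  have h := isCompact_univ.induction_on (X := M)
    (p := fun s => ∃ B : ℝ, 0 ≤ B ∧ ∀ x ∈ s, ∃ e ∈ holCharts n M, x ∈ e.source ∧
      g.JetBound e (e x) B) ⟨0, le_rfl, by simp⟩
    (fun s t hst ⟨B, hB, h⟩ => ⟨B, hB, fun x hx => h x (hst hx)⟩) ?_ ?_
  · obtain ⟨B, hB, h⟩ := h
    exact ⟨B, hB, fun x => h x (mem_univ x)⟩
  · rintro s t ⟨B, hB, hs⟩ ⟨B', hB', ht⟩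
    refine ⟨max B B', le_max_of_le_left hB, ?_⟩
    rintro x (hx | hx)
    · obtain ⟨e, he, hxe, h⟩ := hs x hx
      exact ⟨e, he, hxe, h.mono (le_max_left _ _)⟩
    · obtain ⟨e, he, hxe, h⟩ := ht x hx
      exact ⟨e, he, hxe, h.mono (le_max_right _ _)⟩
  · intro x _
    obtain ⟨B, hB⟩ := eventually_jetBound (g := g) (chartAt_mem_holCharts x) (mem_chart_source _ x)
    refine ⟨_, mem_nhdsWithin_of_mem_nhds hB, max B 0, le_max_right _ _, fun y hy => ?_⟩
    exact ⟨_, chartAt_mem_holCharts x, hy.1, hy.2.mono (le_max_left _ _)⟩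

/-- The function `tr_g g'` on `M`. -/
noncomputable def traceMetric (g : HermitianMetric n M) (φ : M → ℝ) (x : M) : ℝ :=
  g.traceMetricIn (chartAt (Cn n) x) φ (chartAt (Cn n) x x)

theorem traceMetricIn_eq_traceMetric {φ : M → ℝ} (hφ : ContMDiff 𝓘(ℝ, Cn n) 𝓘(ℝ, ℝ) ∞ φ)
    (he : e ∈ holCharts n M) {x : M} (hx : x ∈ e.source) :
    g.traceMetricIn e φ (e x) = g.traceMetric φ x :=
  g.traceMetricIn_eq hφ (chartAt_mem_holCharts x) he (mem_chart_source _ x) hx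

/-- The definition uses a chart varying with the point; independence of the chart allows a fixed
chart near `x`. -/
theorem continuous_traceMetric {φ : M → ℝ} (hφ : ContMDiff 𝓘(ℝ, Cn n) 𝓘(ℝ, ℝ) ∞ φ) :
    Continuous (g.traceMetric φ) := by
  rw [continuous_iff_continuousAt]
  intro x
  set e := chartAt (Cn n) x with hedef
  have he : e ∈ holCharts n M := chartAt_mem_holCharts x
  have hx : x ∈ e.source := mem_chart_source _ x
  have hG := g.smoothMat_coeff he
  have hφc : ContDiffOn ℝ ∞ (fun w => (φ (e.symm w) : ℂ)) e.target :=
    ofRealCLM.contDiff.comp_contDiffOn (contDiffOn_comp_symm hφ he)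
  have hs : ContDiffOn ℝ ∞ (fun z => ((g.coeff e z)⁻¹ * g.coeff' φ e z).trace) e.target :=
    ((hG.inv fun z hz => (g.coeff_posDef he hz).det_pos.ne').mul
      (hG.add (smoothMat_hessian e.open_target hφc))).trace
  have h1 : ContinuousAt (fun z => ((g.coeff e z)⁻¹ * g.coeff' φ e z).trace) (e x) :=
    hs.continuousOn.continuousAt (e.open_target.mem_nhds (e.map_source hx))
  have h2 : ContinuousAt (fun y => g.traceMetricIn e φ (e y)) x :=
    continuous_re.continuousAt.comp (ContinuousAt.comp (g := fun z =>
      ((g.coeff e z)⁻¹ * g.coeff' φ e z).trace) h1 (e.continuousAt hx))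
  refine h2.congr ?_
  filter_upwards [e.open_source.mem_nhds hx] with y hy
  exact traceMetricIn_eq_traceMetric hφ he hy

end HermitianMetric

/-- Here `s = 1/r`. Replacing `s³` by `s⁴` avoids the exponent `3/2`; any polynomial bound in `s` of
degree at most `2` will do. -/
theorem le_mul_sq_of_or {u s β C : ℝ} (hs : 1 ≤ s) (hβ : 0 ≤ β) (hC : 0 ≤ C)
    (h : s⁻¹ ^ 3 * u ^ 2 ≤ β ^ 2 ∨ u ≤ C) : u ≤ (β + C) * s ^ 2 := by
  have hs2 : 1 ≤ s ^ 2 := one_le_pow₀ hs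
  rcases h with h | h
  · have h1 : u ^ 2 ≤ (β * s ^ 2) ^ 2 := by
      rw [inv_pow, inv_mul_le_iff₀ (by positivity)] at h
      calc u ^ 2 ≤ s ^ 3 * β ^ 2 := h
        _ ≤ s ^ 4 * β ^ 2 := by
          gcongr
          · norm_num
        _ = _ := by ring
    have h2 : u ≤ β * s ^ 2 := (abs_le_of_sq_le_sq' h1 (by positivity)).2
    have h3 : 0 ≤ C * s ^ 2 := by positivity
    linarith
  · calc u ≤ C * 1 := by linarith
      _ ≤ (β + C) * s ^ 2 := mul_le_mul (by linarith) hs2 zero_le_one (by linarith)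

/-- From `s ≤ e^{s-1}`. This is where the power of `φ - inf φ + 1` disappears into the exponential.
-/
theorem sq_le_exp_mul {s A : ℝ} (hs : 1 ≤ s) (hA : 2 ≤ A) : s ^ 2 ≤ Real.exp (A * (s - 1)) := by
  have h1 : s ≤ Real.exp (s - 1) := by linarith [Real.add_one_le_exp (s - 1)]
  calc s ^ 2 ≤ Real.exp (s - 1) ^ 2 := pow_le_pow_left₀ (by linarith) h1 2
    _ = Real.exp (2 * (s - 1)) := by rw [← Real.exp_nat_mul]; norm_num
    _ ≤ _ := Real.exp_le_exp.2 (mul_le_mul_of_nonneg_right hA (by linarith))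

variable [IsManifold 𝓘(ℂ, Cn n) ω M]

/-- The second-order estimate, for an arbitrary Hermitian metric. -/
theorem exists_traceMetricIn_le [CompactSpace M] (hn : 0 < n) (g : HermitianMetric n M) (K : ℝ) :
    ∃ C A : ℝ, 0 < C ∧ 0 < A ∧
      ∀ F φ : M → ℝ,
        ContMDiff 𝓘(ℝ, Cn n) 𝓘(ℝ, ℝ) ∞ F →
        ContMDiff 𝓘(ℝ, Cn n) 𝓘(ℝ, ℝ) ∞ φ →
        (∀ x, |F x| ≤ K) →
        (∀ e ∈ holCharts n M, ∀ z ∈ e.target, -K ≤ g.laplacianIn e F z) →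
        g.SolvesMongeAmpere F φ →
        ∀ e ∈ holCharts n M, ∀ x ∈ e.source,
          g.traceMetricIn e φ (e x) ≤ C * Real.exp (A * (φ x - ⨅ y, φ y)) := by
  obtain ⟨B, hB, hbound⟩ := g.exists_uniform_jetBound
  by_cases hK : 0 ≤ K
  swap
  -- For negative `K` no function satisfies `|F| ≤ K` at the given point `x`.
  · refine ⟨1, 1, one_pos, one_pos, fun F φ _ _ hF _ _ e _ x _ => ?_⟩
    exact absurd ((abs_nonneg _).trans (hF x)) hK
  set B' : ℝ := n ^ 4 * (1 + B) ^ 5 with hB'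
  have hB'0 : 0 ≤ B' := by positivity
  set A : ℝ := laplacianConst n B' K + 2 with hA
  have hA2 : 2 ≤ A := by linarith [laplacianConst_nonneg n hB'0 hK]
  set β : ℝ := (A + 1) * (2 * n * B') with hβ
  set C₁ : ℝ := n * (Real.exp K * (1 + (A + 1) * n) ^ n) with hC₁
  have hβ0 : 0 ≤ β := by positivity
  have hC₁0 : 0 < C₁ := by
    have : (0 : ℝ) < n := by exact_mod_cast hn
    positivity
  -- `β + C₁` covers both alternatives at the maximum point; the factor `e` pays for the bounded
  -- term `1/(φ - m + 1)`.
  refine ⟨Real.exp 1 * (β + C₁), A, by positivity, by linarith, ?_⟩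
  intro F φ hF hφ hFK hΔF hsol e he x hx
  rw [HermitianMetric.traceMetricIn_eq_traceMetric hφ he hx]
  have hne : Nonempty M := ⟨x⟩
  have hφcont : Continuous φ := hφ.continuous
  set m : ℝ := ⨅ y, φ y with hm
  have hmle : ∀ y, m ≤ φ y := fun y =>
    ciInf_le (isCompact_range hφcont).bddBelow y
  have hupos : ∀ y, 0 < g.traceMetric φ y := fun y => by
    have hy := mem_chart_source (Cn n) y
    have hc := chartAt_mem_holCharts (n := n) y
    have hz := (chartAt (Cn n) y).map_source hy
    exact (trace_inv_mul_pos hn (g.coeff_posDef hc hz) (hsol _ hc _ hz).1).1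
  have hucont : Continuous (g.traceMetric φ) := HermitianMetric.continuous_traceMetric hφ
  have hs0 : ∀ y, 0 < φ y - m + 1 := fun y => by linarith [hmle y]
  set Q : M → ℝ := fun y => Real.log (g.traceMetric φ y) - A * φ y + (φ y - m + 1)⁻¹ with hQ
  have hQcont : Continuous Q :=
    ((hucont.log fun y => (hupos y).ne').sub (continuous_const.mul hφcont)).add
      (((hφcont.sub continuous_const).add continuous_const).inv₀ fun y => (hs0 y).ne')
  obtain ⟨x₀, -, hx₀⟩ := isCompact_univ.exists_isMaxOn univ_nonempty hQcont.continuousOn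
  have hmaxQ : ∀ y, Q y ≤ Q x₀ := fun y => hx₀ (mem_univ y)
  -- The maximum point depends on `F` and `φ`, but the jets of `g` in this chart obey the bound `B`
  -- chosen beforehand.
  obtain ⟨e₀, he₀, hxe₀, hJ⟩ := hbound x₀
  have hp : e₀ x₀ ∈ e₀.target := e₀.map_source hxe₀
  have hu₀ : ∀ z ∈ e₀.target, ((g.coeff e₀ z)⁻¹ * (g.coeff e₀ z +
      hessian (fun w => (φ (e₀.symm w) : ℂ)) z)).trace.re = g.traceMetric φ (e₀.symm z) := by
    intro z hz
    rw [← HermitianMetric.traceMetricIn_eq_traceMetric hφ he₀ (e₀.map_target hz), e₀.right_inv hz]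
    rfl
  have hlocmax : IsLocalMax (fun z => Real.log ((g.coeff e₀ z)⁻¹ * (g.coeff e₀ z +
      hessian (fun w => (φ (e₀.symm w) : ℂ)) z)).trace.re - A * φ (e₀.symm z) +
      (φ (e₀.symm z) - m + 1)⁻¹) (e₀ x₀) := by
    filter_upwards [e₀.open_target.mem_nhds hp] with z hz
    rw [hu₀ z hz, hu₀ _ hp, e₀.left_inv hxe₀]
    exact hmaxQ _
  have hest := trace_le_of_isLocalMax hn e₀.open_target hp (g.smoothMat_coeff he₀)
    (fun z hz => g.coeff_posDef he₀ hz) (contDiffOn_comp_symm hφ he₀) (contDiffOn_comp_symm hF he₀)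
    (fun z hz => (hsol e₀ he₀ z hz).1)
    (fun z hz => by
      have h := det_eq_of_wedgePow_eq (hsol e₀ he₀ z hz).2
      rw [ofReal_exp] at h
      exact h)
    hJ.1 hJ.2.1 hJ.2.2 (hFK _) (hΔF e₀ he₀ _ hp) (fun z _ => hmle _) hA hlocmax
  rw [hu₀ _ hp, e₀.left_inv hxe₀] at hest
  set s : ℝ := φ x₀ - m + 1 with hs
  have hs1 : 1 ≤ s := by linarith [hmle x₀]
  set u₀ := g.traceMetric φ x₀ with hu₀def
  have hu₀pos : 0 < u₀ := hupos x₀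
  have hu₀le : u₀ ≤ (β + C₁) * s ^ 2 := le_mul_sq_of_or hs1 hβ0 hC₁0.le hest
  -- This is `Q x ≤ Q x₀`, with the reciprocal at `x` discarded as positive and the one at `x₀`
  -- bounded by `1`.
  have hlog : Real.log (g.traceMetric φ x) ≤ Real.log u₀ + (A * (φ x - φ x₀) + 1) := by
    have h1 := hmaxQ x
    have h2 : 0 < (φ x - m + 1)⁻¹ := inv_pos.2 (hs0 x)
    have h3 : (φ x₀ - m + 1)⁻¹ ≤ 1 := inv_le_one_of_one_le₀ hs1
    simp only [hQ] at h1
    linarith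
  calc g.traceMetric φ x = Real.exp (Real.log (g.traceMetric φ x)) := (Real.exp_log (hupos x)).symm
    _ ≤ Real.exp (Real.log u₀ + (A * (φ x - φ x₀) + 1)) := Real.exp_le_exp.2 hlog
    _ = u₀ * Real.exp (A * (φ x - φ x₀) + 1) := by rw [Real.exp_add, Real.exp_log hu₀pos]
    _ ≤ (β + C₁) * Real.exp (A * (s - 1)) * Real.exp (A * (φ x - φ x₀) + 1) := by
        gcongr
        exact hu₀le.trans (mul_le_mul_of_nonneg_left (sq_le_exp_mul hs1 hA2) (by positivity))
    -- As `s - 1 = φ x₀ - m`, the value of `φ` at the maximum point cancels from the exponent.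
    _ = Real.exp 1 * (β + C₁) * Real.exp (A * (φ x - m)) := by
        have h1 : Real.exp (A * (φ x - m)) * Real.exp 1 =
            Real.exp (A * (s - 1)) * Real.exp (A * (φ x - φ x₀) + 1) := by
          rw [← Real.exp_add, ← Real.exp_add]
          congr 1
          rw [hs]
          ring
        linear_combination -(β + C₁) * h1

end Global

end HermitianMA

open HermitianMA in
theorem theorem2p1 {n : ℕ} {M : Type*} [TopologicalSpace M] [T2Space M] [CompactSpace M]
    [ChartedSpace (Cn n) M] [IsManifold 𝓘(ℂ, Cn n) ω M]
    (g : HermitianMetric n M)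
    (hn : n = 2 ∨ (2 < n ∧ g.IsBalanced)) (K : ℝ) :
    ∃ C A : ℝ, 0 < C ∧ 0 < A ∧
      ∀ F φ : M → ℝ,
        ContMDiff 𝓘(ℝ, Cn n) 𝓘(ℝ, ℝ) ∞ F →
        ContMDiff 𝓘(ℝ, Cn n) 𝓘(ℝ, ℝ) ∞ φ →
        (∀ x, |F x| ≤ K) →
        (∀ e ∈ holCharts n M, ∀ z ∈ e.target, |g.laplacianIn e F z| ≤ K) →
        g.SolvesMongeAmpere F φ →
        ⨆ x, φ x = 0 →
        ∀ e ∈ holCharts n M, ∀ x ∈ e.source,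
          g.traceMetricIn e φ (e x) ≤ C * Real.exp (A * (φ x - ⨅ y, φ y)) := by
  have hpos : 0 < n := by omega
  obtain ⟨C, A, hC, hA, h⟩ := exists_traceMetricIn_le hpos g K
  exact ⟨C, A, hC, hA, fun F φ hF hφ hFK hΔF hsol _ =>
    h F φ hF hφ hFK (fun e he z hz => (abs_le.1 (hΔF e he z hz)).1) hsol⟩
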